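/- Let $\mathcal X$ be a measurable space, $\mathcal Y$ a finite set of classes, $\Delta_{\mathcal Y}$ the simplex over $\mathcal Y$, $\mathcal H$ a family of hypotheses $h\colon\mathcal X\to\Delta_{\mathcal Y}$, and $\ell\colon\Delta_{\mathcal Y}\times\mathcal Y\to[0,M]$ a loss. For a distribution $\mathcal D$ on $\mathcal X\times\mathcal Y$ put $\mathcal L_{\mathcal D}(h)=\mathbb E_{(x,y)\sim\mathcal D}[\ell(h(x),y)]$ and $\mathrm{disc}_{\mathcal H}(\mathcal D,\mathcal D')=\sup_{h\in\mathcal H}|\mathcal L_{\mathcal D}(h)-\mathcal L_{\mathcal D'}(h)|$. Let $d<\infty$ be the pseudo-dimension of the family of losses $\{(x,y)\mapsto\ell(h(x),y):h\in\mathcal H\}$ (its VC-dimension if the losses take two values); this family is assumed measurable in the usual sense of empirical process theory (its members are measurable, and so are, up to $\mathcal D_0^n$-null sets, the functions $(z_1,\dots,z_n)\mapsto\sup_{h}|\sum_i a_i\ell(h(x_i),y_i)|$, $z_i=(x_i,y_i)$, for all $n$ and $a\in\mathbb R^n$). Let $\mathcal D_0$ be the target distribution and $\mathcal D_1,\dots,\mathcal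 D_p$ ($p\ge1$) the source distributions on $\mathcal X\times\mathcal Y$. For each $k=0,\dots,p$ one observes $m_k\ge1$ independent samples from $\mathcal D_k$, with empirical distribution $\widehat{\mathcal D}_k$. Let $m=\sum_{k=1}^p m_k$, let $\Delta_p$ be the set of probability vectors $\lambda=(\lambda_1,\dots,\lambda_p)$, and put $\overline{\mathcal D}_\lambda=\sum_{k=1}^p\lambda_k\widehat{\mathcal D}_k$ and $\mathfrak s(\lambda\|\mathbf m)=\sum_{k=1}^p\frac{\lambda_k^2}{m_k/m}$. For $c>0$, $\epsilon>0$ and $\delta\in(0,1]$ define $$C_\epsilon(\lambda)=\mathrm{disc}_{\mathcal H}(\widehat{\mathcal D}_0,\overline{\mathcal D}_\lambda)+\frac{cM\sqrt{d+\log\frac1\delta}}{\sqrt{m_0}}+\epsilon M+\frac{cM\sqrt{\mathfrak s(\lambda\|\mathbf m)}}{\sqrt m}\sqrt{d\log\frac{em}{d}+p\log\frac1{\epsilon\delta}}$$ (where $d\log\frac{em}{d}$ is read as $0$ if $d=0$, and $\sqrt t$ as $0$ for $t<0$). There is a universal constant $c>0$ such that in every such situation the following holds. With probability at least $1-2\delta$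 over the samples, every solution $h_R$ of $$\min_{h\in\mathcal H}\ \min_{\lambda\in\Delta_p}\ \bigl(\mathcal L_{\overline{\mathcal D}_\lambda}(h)+C_\epsilon(\lambda)\bigr)$$ satisfies $$\mathcal L_{\mathcal D_0}(h_R)\le\inf_{h\in\mathcal H}\mathcal L_{\mathcal D_0}(h)+2\min_{\lambda\in\Delta_p}C_\epsilon(\lambda).$$ Moreover, $C_\epsilon(\lambda)\ge cM\sqrt{d/m_0}$ for all samples and all $\lambda\in\Delta_p$, so that this guarantee is of no smaller order than the term $\sqrt{d/m_0}$ in the bound for training on the target samples alone. -/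

import Mathlib

open MeasureTheory ProbabilityTheory
open scoped ENNReal BigOperators

noncomputable section

section Learning

variable {X Y : Type*} [Fintype Y]

/-- The loss function `(x, y) ↦ ℓ(h(x), y)` of a hypothesis `h : X → Δ_Y`. -/
def lossFun (ℓ : stdSimplex ℝ Y → Y → ℝ) (h : X → stdSimplex ℝ Y) : X × Y → ℝ :=
  fun z => ℓ (h z.1) z.2

/-- The family of losses `{(x, y) ↦ ℓ(h(x), y) : h ∈ H}`. -/
def lossClass (ℓ : stdSimplex ℝ Y → Y → ℝ) (H : Set (X → stdSimplex ℝ Y)) : Set (X × Y → ℝ) :=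
  lossFun ℓ '' H

/-- A finite set `s` is shattered by a class `G` of real functions if, for some thresholds `t`,
the subgraphs cut out every subset of `s`. For `{0, M}`-valued functions with `M > 0` this is the
usual shattering of `s` by the sets `{g = M}`. -/
def PseudoShatters {Z : Type*} (G : Set (Z → ℝ)) (s : Finset Z) : Prop :=
  ∃ t : Z → ℝ, ∀ u ⊆ s, ∃ g ∈ G, ∀ z ∈ s, (z ∈ u ↔ t z < g z)

/-- The pseudo-dimension: the largest size of a shattered finite set (`⊤` if unbounded). It is the
VC-dimension when the functions take two values. -/
def pseudoDim {Z : Type*} (G : Set (Z → ℝ)) : ℕ∞ :=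
  ⨆ (s : Finset Z) (_ : PseudoShatters G s), (s.card : ℕ∞)

/-- A class of functions is measurable for `D` if for all weights `a₁, …, aₙ` the function
`(z₁, …, zₙ) ↦ sup_g |∑ aᵢ g(zᵢ)|` is measurable for the completion of `Dⁿ`. -/
def IsMeasurableClass {Z : Type*} [MeasurableSpace Z] (G : Set (Z → ℝ)) (D : Measure Z) : Prop :=
  (∀ g ∈ G, Measurable g) ∧
    ∀ (n : ℕ) (a : Fin n → ℝ),
      AEMeasurable (fun z : Fin n → Z => ⨆ g : G, |∑ i, a i * g.1 (z i)|)
        (Measure.pi fun _ : Fin n => D)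

/-- The uniform distribution on the points of a sample. -/
def empirical {Z : Type*} [MeasurableSpace Z] {n : ℕ} (S : Fin n → Z) : Measure Z :=
  (n : ℝ≥0∞)⁻¹ • ∑ i, Measure.dirac (S i)

/-- The mixture `∑ₖ λₖ Dₖ`. -/
def mixture {Z : Type*} [MeasurableSpace Z] {p : ℕ} (lam : Fin p → ℝ) (D : Fin p → Measure Z) :
    Measure Z :=
  ∑ k, ENNReal.ofReal (lam k) • D k

/-- The mixed empirical distribution `∑ₖ λₖ D̂ₖ`. -/
def mixedEmpirical {Z : Type*} [MeasurableSpace Z] {p : ℕ} {m : Fin p → ℕ}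
    (S : ∀ k, Fin (m k) → Z) (lam : Fin p → ℝ) : Measure Z :=
  mixture lam fun k => empirical (S k)

/-- The skewness `∑ₖ λₖ² / 𝐦ₖ`, where `𝐦ₖ = mₖ / m` and `m = ∑ₖ mₖ`. -/
def skewness {p : ℕ} (lam : Fin p → ℝ) (m : Fin p → ℕ) : ℝ :=
  ∑ k, lam k ^ 2 / ((m k : ℝ) / ((∑ j, m j : ℕ) : ℝ))

variable [MeasurableSpace X] [MeasurableSpace Y]

/-- The expected loss of `h` under `D`. -/
def expLoss (ℓ : stdSimplex ℝ Y → Y → ℝ) (D : Measure (X × Y)) (h : X → stdSimplex ℝ Y) : ℝ :=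
  ∫ z, ℓ (h z.1) z.2 ∂D

/-- The label-discrepancy `sup_{h ∈ H} |L_D(h) - L_D'(h)|`. -/
def disc (ℓ : stdSimplex ℝ Y → Y → ℝ) (H : Set (X → stdSimplex ℝ Y)) (D D' : Measure (X × Y)) :
    ℝ :=
  ⨆ h : H, |expLoss ℓ D h.1 - expLoss ℓ D' h.1|

/-- The penalty `C_ε(λ)`, computed from the target sample `S₀` (of size `m₀`) and the source
samples `S₁, …, S_p` (of sizes `m₁, …, m_p`). -/
def penalty (ℓ : stdSimplex ℝ Y → Y → ℝ) (H : Set (X → stdSimplex ℝ Y)) (c M ε δ : ℝ) (d : ℕ)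
    {p m₀ : ℕ} {m : Fin p → ℕ} (S₀ : Fin m₀ → X × Y) (S : ∀ k, Fin (m k) → X × Y)
    (lam : Fin p → ℝ) : ℝ :=
  disc ℓ H (empirical S₀) (mixedEmpirical S lam)
    + c * M * √(d + Real.log (1 / δ)) / √m₀
    + ε * M
    + c * M * √(skewness lam m) / √((∑ k, m k : ℕ) : ℝ)
      * √(d * Real.log (Real.exp 1 * ((∑ k, m k : ℕ) : ℝ) / d) + p * Real.log (1 / (ε * δ)))

/-- The objective `h ↦ min_{λ ∈ Δ_p} (L_{D̄_λ}(h) + C_ε(λ))`. -/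
def objective (ℓ : stdSimplex ℝ Y → Y → ℝ) (H : Set (X → stdSimplex ℝ Y)) (c M ε δ : ℝ) (d : ℕ)
    {p m₀ : ℕ} {m : Fin p → ℕ} (S₀ : Fin m₀ → X × Y) (S : ∀ k, Fin (m k) → X × Y)
    (h : X → stdSimplex ℝ Y) : ℝ :=
  ⨅ lam : stdSimplex ℝ (Fin p),
    (expLoss ℓ (mixedEmpirical S lam.1) h + penalty ℓ H c M ε δ d S₀ S lam.1)

/-- `h` is a solution of the optimization problem: it minimizes the objective over `H`. -/
def IsSolution (ℓ : stdSimplex ℝ Y → Y → ℝ) (H : Set (X → stdSimplex ℝ Y)) (c M ε δ : ℝ) (d : ℕ)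
    {p m₀ : ℕ} {m : Fin p → ℕ} (S₀ : Fin m₀ → X × Y) (S : ∀ k, Fin (m k) → X × Y)
    (h : X → stdSimplex ℝ Y) : Prop :=
  h ∈ H ∧ ∀ h' ∈ H, objective ℓ H c M ε δ d S₀ S h ≤ objective ℓ H c M ε δ d S₀ S h'

end Learning

end

/-! The oracle inequality is deterministic on the event that the target sample estimates every loss
within Δ = cM√(d + log(1/δ))/√m₀. There, for every λ, L_{D₀}(h) and the λ-mixed empirical loss
differ by at most disc + Δ ≤ C_ε(λ). So the objective at h_R is at least L_{D₀}(h_R), and the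
objective at any h is at most L_{D₀}(h) + 2C_ε(λ) (`expLoss_le_of_isSolution`). The source samples
are compared with the target sample through the discrepancy alone, so no concentration of the
sources is needed.

What remains is uniform convergence on the target sample at rate √(d/m₀), with no logarithm of m₀
(`measure_exists_abs_sum_sub_gt_le`). A ghost sample and random signs reduce it to a Rademacher
process on fixed points. Discretized subgraphs turn bounded functions into subsets of a grid whose
VC-dimension is at most the pseudo-dimension. A family of sets of VC-dimension d that is η-separated
has at most 2(4/η)^{2d} members (`card_le_of_separated`), independently of the size of the ground
set. Chaining over nets of radius 4^{-k} then loses only a constant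
(`card_exists_sgn_fibreAvg_gt_le`). -/

noncomputable section

/-! ### Packing numbers of families of bounded VC-dimension. -/

section Packing

/-- For k ≤ d the factor x^(k-d) is at least 1; inserting it lets the binomial theorem and 1 + x ≤
e^x finish. -/
theorem sum_choose_le_inv_pow_mul_exp (K d : ℕ) {x : ℝ} (hx : 0 < x) (hx1 : x ≤ 1) :
    ∑ k ∈ Finset.Iic d, (K.choose k : ℝ) ≤ x⁻¹ ^ d * Real.exp (x * K) := by
  have h1 : ∑ k ∈ Finset.Iic d, x ^ k * (K.choose k : ℝ) ≤ (x + 1) ^ K := by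
    rw [add_pow]
    simp only [one_pow, mul_one]
    rw [← Finset.sum_filter_add_sum_filter_not (Finset.Iic d) (fun k => k ≤ K)]
    have hz : ∑ k ∈ Finset.Iic d with ¬ k ≤ K, x ^ k * (K.choose k : ℝ) = 0 := by
      refine Finset.sum_eq_zero fun k hk => ?_
      rw [Nat.choose_eq_zero_of_lt (not_le.1 (Finset.mem_filter.1 hk).2)]
      simp
    rw [hz, add_zero]
    refine Finset.sum_le_sum_of_subset_of_nonneg (fun k hk => ?_) (fun _ _ _ => by positivity)
    exact Finset.mem_range.2 (Nat.lt_succ_of_le (Finset.mem_filter.1 hk).2)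
  have h2 : (x + 1) ^ K ≤ Real.exp (x * K) := by
    rw [mul_comm, Real.exp_nat_mul]
    gcongr
    exact Real.add_one_le_exp x
  calc ∑ k ∈ Finset.Iic d, (K.choose k : ℝ)
      ≤ ∑ k ∈ Finset.Iic d, x⁻¹ ^ d * (x ^ k * (K.choose k : ℝ)) := by
        refine Finset.sum_le_sum fun k hk => ?_
        rw [← mul_assoc]
        refine le_mul_of_one_le_left (by positivity) ?_
        have hk : k ≤ d := Finset.mem_Iic.1 hk
        rw [inv_pow, inv_mul_eq_div, one_le_div (by positivity)]
        exact pow_le_pow_of_le_one hx.le hx1 hk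
    _ ≤ _ := by
        rw [← Finset.mul_sum]
        gcongr
        exact h1.trans h2

/-- Few random points of `V` distinguish all members of a separated family. -/
theorem exists_points_distinguish {V : Type*} [Fintype V] [Nonempty V] [DecidableEq V]
    (𝒜 : Finset (Finset V)) {η : ℝ}
    (hsep : ∀ A ∈ 𝒜, ∀ B ∈ 𝒜, A ≠ B → η * Fintype.card V ≤ (symmDiff A B).card)
    {K : ℕ} (hK : (𝒜.card : ℝ) ^ 2 ≤ Real.exp (η * K)) :
    ∃ v : Fin K → V, ∀ A ∈ 𝒜, ∀ B ∈ 𝒜, A ≠ B → ∃ i, v i ∈ symmDiff A B := by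
  by_contra! hcon
  rcases 𝒜.eq_empty_or_nonempty with rfl | hne
  · obtain ⟨A, hA, _⟩ := hcon fun _ => Classical.arbitrary V
    simp at hA
  have hN : (0 : ℝ) < 𝒜.card := by exact_mod_cast hne.card_pos
  have hV : (0 : ℝ) < Fintype.card V := by exact_mod_cast Fintype.card_pos
  -- Union bound by counting: K uniform points all miss a given difference with probability at most
  -- (1-η)^K ≤ 1/N², and there are fewer than N² ordered pairs of distinct members.
  have hcover : (Finset.univ : Finset (Fin K → V)) ⊆ 𝒜.offDiag.biUnion
      fun q => Fintype.piFinset fun _ => (symmDiff q.1 q.2)ᶜ := by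
    intro v _
    obtain ⟨A, hA, B, hB, hAB, hv⟩ := hcon v
    refine Finset.mem_biUnion.2 ⟨(A, B), Finset.mem_offDiag.2 ⟨hA, hB, hAB⟩, ?_⟩
    exact Fintype.mem_piFinset.2 fun i => Finset.mem_compl.2 (hv i)
  have hc := (Finset.card_le_card hcover).trans Finset.card_biUnion_le
  have hc' : (Fintype.card V : ℝ) ^ K ≤
      ∑ q ∈ 𝒜.offDiag, ((symmDiff q.1 q.2)ᶜ.card : ℝ) ^ K := by
    simp only [Finset.card_univ, Fintype.card_pi, Fintype.card_piFinset, Finset.prod_const,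
      Fintype.card_fin] at hc
    exact_mod_cast hc
  have hterm : ∀ q ∈ 𝒜.offDiag, ((symmDiff q.1 q.2)ᶜ.card : ℝ) ^ K
      ≤ (Fintype.card V : ℝ) ^ K / (𝒜.card : ℝ) ^ 2 := by
    intro q hq
    obtain ⟨hA, hB, hAB⟩ := Finset.mem_offDiag.1 hq
    have h1 := hsep _ hA _ hB hAB
    have h2 : ((symmDiff q.1 q.2)ᶜ.card : ℝ) ≤ Real.exp (-η) * Fintype.card V := by
      rw [Finset.card_compl, Nat.cast_sub (Finset.card_le_univ _)]
      have := Real.add_one_le_exp (-η)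
      nlinarith
    calc ((symmDiff q.1 q.2)ᶜ.card : ℝ) ^ K ≤ (Real.exp (-η) * Fintype.card V) ^ K := by gcongr
      _ = (Fintype.card V : ℝ) ^ K / Real.exp (η * K) := by
        rw [mul_pow, ← Real.exp_nat_mul, mul_comm, mul_neg, Real.exp_neg, div_eq_mul_inv,
          mul_comm η]
      _ ≤ _ := by gcongr
  have hlt : (𝒜.offDiag.card : ℝ) < (𝒜.card : ℝ) ^ 2 := by
    rw [Finset.offDiag_card, Nat.cast_sub (Nat.le_mul_self _), Nat.cast_mul]
    nlinarith
  have := hc'.trans (Finset.sum_le_sum hterm)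
  rw [Finset.sum_const, nsmul_eq_mul, mul_div_assoc', le_div_iff₀ (by positivity)] at this
  have hVK : 0 < (Fintype.card V : ℝ) ^ K := by positivity
  nlinarith

/-- A separated family whose shattered sets have at most `d` points is small. -/
theorem card_le_of_separated {V : Type*} [Fintype V] [Nonempty V] [DecidableEq V]
    (𝒜 : Finset (Finset V)) {d : ℕ} (hd : ∀ s, 𝒜.Shatters s → s.card ≤ d)
    {η : ℝ} (hη : 0 < η) (hη1 : η ≤ 1)
    (hsep : ∀ A ∈ 𝒜, ∀ B ∈ 𝒜, A ≠ B → η * Fintype.card V ≤ (symmDiff A B).card) :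
    (𝒜.card : ℝ) ≤ 2 * (4 / η) ^ (2 * d) := by
  rcases 𝒜.eq_empty_or_nonempty with rfl | hne
  · simp; positivity
  have hN : (0 : ℝ) < 𝒜.card := by exact_mod_cast hne.card_pos
  have hN1 : (1 : ℝ) ≤ 𝒜.card := by exact_mod_cast hne.card_pos
  set N : ℝ := (𝒜.card : ℝ)
  have hlog : 0 ≤ Real.log N := Real.log_nonneg hN1
  set K := ⌈2 * Real.log N / η⌉₊ with hKdef
  have hK1 : 2 * Real.log N / η ≤ K := Nat.le_ceil _
  have hK2 : (K : ℝ) < 2 * Real.log N / η + 1 := Nat.ceil_lt_add_one (by positivity)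
  obtain ⟨v, hv⟩ := exists_points_distinguish 𝒜 hsep (K := K) (by
    have : 2 * Real.log N ≤ η * K := by rw [div_le_iff₀ hη] at hK1; linarith
    calc N ^ 2 = Real.exp (2 * Real.log N) := by
          rw [two_mul, Real.exp_add, Real.exp_log hN, sq]
      _ ≤ _ := Real.exp_le_exp.2 this)
  let tr : Finset V → Finset (Fin K) := fun A => Finset.univ.filter fun i => v i ∈ A
  have hinj : Set.InjOn tr 𝒜 := by
    intro A hA B hB h
    by_contra hAB
    obtain ⟨i, hi⟩ := hv A hA B hB hAB
    have : i ∈ tr A ↔ i ∈ tr B := by rw [h]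
    simp only [tr, Finset.mem_filter, Finset.mem_univ, true_and] at this
    rw [Finset.mem_symmDiff] at hi
    tauto
  have hvc : (𝒜.image tr).vcDim ≤ d := by
    refine Finset.sup_le fun I hI => ?_
    have hI : (𝒜.image tr).Shatters I := Finset.mem_shatterer.1 hI
    have key : ∀ J ⊆ I, ∃ A ∈ 𝒜, ∀ i ∈ I, (v i ∈ A ↔ i ∈ J) := by
      intro J hJ
      obtain ⟨u, hu, huJ⟩ := hI hJ
      obtain ⟨A, hA, rfl⟩ := Finset.mem_image.1 hu
      refine ⟨A, hA, fun i hi => ?_⟩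
      rw [← huJ]
      simp [tr, hi]
    -- Two indices with the same point cannot be told apart by traces, so a shattered index set maps
    -- injectively to a shattered set of points.
    have hvinj : Set.InjOn v I := by
      intro i hi j hj hij
      obtain ⟨A, -, hA⟩ := key {i} (by simpa using hi)
      have h1 := (hA i hi).2 (by simp)
      rw [hij, hA j hj] at h1
      exact (Finset.mem_singleton.1 h1).symm
    rw [← Finset.card_image_of_injOn hvinj]
    refine hd _ fun t ht => ?_
    obtain ⟨A, hA, hAt⟩ := key (I.filter fun i => v i ∈ t) (Finset.filter_subset _ _)
    refine ⟨A, hA, ?_⟩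
    ext x
    simp only [Finset.mem_inter, Finset.mem_image]
    constructor
    · rintro ⟨⟨i, hi, rfl⟩, hx⟩
      exact (Finset.mem_filter.1 ((hAt i hi).1 hx)).2
    · intro hx
      obtain ⟨i, hi, rfl⟩ := Finset.mem_image.1 (ht hx)
      exact ⟨⟨i, hi, rfl⟩, (hAt i hi).2 (Finset.mem_filter.2 ⟨hi, hx⟩)⟩
  have hcard : N ≤ ∑ k ∈ Finset.Iic d, (K.choose k : ℝ) := by
    have h1 : 𝒜.card ≤ ∑ k ∈ Finset.Iic d, K.choose k := by
      rw [← Finset.card_image_of_injOn hinj]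
      refine (Finset.card_le_card_shatterer _).trans
        (Finset.card_shatterer_le_sum_vcDim.trans ?_)
      rw [Fintype.card_fin]
      exact Finset.sum_le_sum_of_subset (Finset.Iic_subset_Iic.2 hvc)
    show ((𝒜.card : ℕ) : ℝ) ≤ _
    exact_mod_cast h1
  -- With x = η/4 and K ≈ 2 log N/η the exponential costs only about √N, which the left side
  -- absorbs; this squares (4/η)^d.
  have h2 := hcard.trans (sum_choose_le_inv_pow_mul_exp K d (x := η / 4) (by positivity)
    (by linarith))
  have h3 : η / 4 * K ≤ Real.log N / 2 + 1 / 4 := by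
    have : η * K ≤ 2 * Real.log N + η := by
      calc η * K ≤ η * (2 * Real.log N / η + 1) := by gcongr
        _ = _ := by field_simp
    linarith
  have h4 : N ≤ (4 / η) ^ d * Real.exp (Real.log N / 2 + 1 / 4) := by
    refine h2.trans ?_
    rw [inv_div]
    gcongr
  have h5 : N ^ 2 ≤ ((4 / η) ^ (2 * d)) * (N * Real.exp (1 / 2)) := by
    calc N ^ 2 ≤ ((4 / η) ^ d * Real.exp (Real.log N / 2 + 1 / 4)) ^ 2 := by gcongr
      _ = _ := by
        rw [mul_pow, ← pow_mul, mul_comm d 2, ← Real.exp_nat_mul]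
        congr 1
        rw [show ((2 : ℕ) : ℝ) * (Real.log N / 2 + 1 / 4) = Real.log N + 1 / 2 by push_cast; ring,
          Real.exp_add, Real.exp_log hN]
  have h6 : Real.exp (1 / 2) ≤ 2 := by
    have h := Real.exp_one_lt_d9
    have : Real.exp (1 / 2) ^ 2 = Real.exp 1 := by rw [← Real.exp_nat_mul]; norm_num
    nlinarith [Real.exp_pos (1 / 2)]
  have h7 : (0 : ℝ) < (4 / η) ^ (2 * d) := by positivity
  have h8 : N * N ≤ 2 * (4 / η) ^ (2 * d) * N := by
    calc N * N = N ^ 2 := (sq N).symm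
      _ ≤ _ := h5
      _ ≤ (4 / η) ^ (2 * d) * (N * 2) := by gcongr
      _ = _ := by ring
  exact le_of_mul_le_mul_right h8 hN

/-- Maximal separated subfamilies are nets. -/
theorem exists_net {V : Type*} [Fintype V] [Nonempty V] [DecidableEq V]
    (𝒜 : Finset (Finset V)) {d : ℕ} (hd : ∀ s, 𝒜.Shatters s → s.card ≤ d)
    {η : ℝ} (hη : 0 < η) (hη1 : η ≤ 1) :
    ∃ ℬ ⊆ 𝒜, (ℬ.card : ℝ) ≤ 2 * (4 / η) ^ (2 * d) ∧
      ∀ A ∈ 𝒜, ∃ B ∈ ℬ, ((symmDiff A B).card : ℝ) < η * Fintype.card V := by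
  classical
  let 𝒮 := 𝒜.powerset.filter fun ℬ => ∀ A ∈ ℬ, ∀ B ∈ ℬ, A ≠ B →
    η * Fintype.card V ≤ (symmDiff A B).card
  obtain ⟨ℬ, hℬ, hmax⟩ := 𝒮.exists_maximalFor Finset.card ⟨∅, by simp [𝒮]⟩
  obtain ⟨hsub, hsep⟩ := Finset.mem_filter.1 hℬ
  rw [Finset.mem_powerset] at hsub
  have hV : (0 : ℝ) < Fintype.card V := by exact_mod_cast Fintype.card_pos
  refine ⟨ℬ, hsub, card_le_of_separated ℬ (fun s hs => hd s (hs.mono_left hsub)) hη hη1 hsep, ?_⟩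
  intro A hA
  by_cases hAB : A ∈ ℬ
  · exact ⟨A, hAB, by simpa using by positivity⟩
  by_contra! hfar
  have hmem : insert A ℬ ∈ 𝒮 := by
    refine Finset.mem_filter.2 ⟨Finset.mem_powerset.2 (Finset.insert_subset hA hsub), ?_⟩
    intro B hB C hC hBC
    rcases Finset.mem_insert.1 hB with rfl | hB' <;> rcases Finset.mem_insert.1 hC with rfl | hC'
    · exact absurd rfl hBC
    · exact hfar C hC'
    · rw [symmDiff_comm]; exact hfar B hB'
    · exact hsep B hB' C hC' hBC
  have := hmax hmem (Finset.card_le_card (Finset.subset_insert _ _))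
  rw [Finset.card_insert_of_notMem hAB] at this
  omega

end Packing

/-! ### Sub-Gaussian tails of signed sums. -/

section Signs

/-- The sign `±1` encoded by a Boolean. -/
def sgn (b : Bool) : ℝ := if b then 1 else -1

theorem abs_sgn (b : Bool) : |sgn b| = 1 := by cases b <;> simp [sgn]

variable {ι : Type*} [Fintype ι] [DecidableEq ι]

theorem sum_exp_sgn_le (f : ι → ℝ) :
    ∑ σ : ι → Bool, Real.exp (∑ i, sgn (σ i) * f i)
      ≤ 2 ^ Fintype.card ι * Real.exp ((∑ i, f i ^ 2) / 2) := by
  have h : ∑ σ : ι → Bool, Real.exp (∑ i, sgn (σ i) * f i) = ∏ i, (2 * Real.cosh (f i)) := by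
    simp_rw [Real.exp_sum]
    rw [← Fintype.prod_sum (fun i (b : Bool) => Real.exp (sgn b * f i))]
    refine Finset.prod_congr rfl fun i _ => ?_
    simp only [Fintype.sum_bool, sgn, if_true, Real.cosh_eq]
    simp
    ring
  rw [h, Finset.sum_div, Real.exp_sum, Finset.prod_mul_distrib, Finset.prod_const,
    Finset.card_univ]
  gcongr
  exact Real.cosh_le_exp_half_sq _

/-- Chernoff's bound with the optimal exponent r = u/v, written as a count of sign vectors. -/
theorem card_sgn_sum_gt_le (f : ι → ℝ) {v u : ℝ} (hv : 0 < v) (hf : ∑ i, f i ^ 2 ≤ v)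
    (hu : 0 ≤ u) :
    ((Finset.univ.filter fun σ : ι → Bool => u < ∑ i, sgn (σ i) * f i).card : ℝ)
      ≤ 2 ^ Fintype.card ι * Real.exp (-(u ^ 2 / (2 * v))) := by
  set r := u / v
  have hr : 0 ≤ r := by positivity
  have h1 : ((Finset.univ.filter fun σ : ι → Bool => u < ∑ i, sgn (σ i) * f i).card : ℝ)
      * Real.exp (r * u) ≤ 2 ^ Fintype.card ι * Real.exp ((∑ i, (r * f i) ^ 2) / 2) := by
    refine le_trans ?_ (sum_exp_sgn_le fun i => r * f i)
    rw [← nsmul_eq_mul, ← Finset.sum_const]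
    refine (Finset.sum_le_sum fun σ hσ => ?_).trans
      (Finset.sum_le_sum_of_subset_of_nonneg (Finset.filter_subset _ _)
        fun _ _ _ => (Real.exp_pos _).le)
    refine Real.exp_le_exp.2 ?_
    have := (Finset.mem_filter.1 hσ).2
    calc r * u ≤ r * ∑ i, sgn (σ i) * f i := by gcongr
      _ = _ := by rw [Finset.mul_sum]; exact Finset.sum_congr rfl fun _ _ => by ring
  have h2 : (∑ i, (r * f i) ^ 2) / 2 ≤ u ^ 2 / (2 * v) := by
    simp_rw [mul_pow]
    rw [← Finset.mul_sum]
    calc r ^ 2 * (∑ i, f i ^ 2) / 2 ≤ r ^ 2 * v / 2 := by gcongr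
      _ = _ := by simp only [r]; field_simp
  have h3 : r * u = u ^ 2 / (2 * v) + u ^ 2 / (2 * v) := by simp only [r]; field_simp; ring
  rw [← le_div_iff₀ (Real.exp_pos _)] at h1
  refine h1.trans ?_
  rw [mul_div_assoc, ← Real.exp_sub]
  gcongr
  linarith

theorem card_abs_sgn_sum_gt_le (f : ι → ℝ) {v u : ℝ} (hv : 0 < v) (hf : ∑ i, f i ^ 2 ≤ v)
    (hu : 0 ≤ u) :
    ((Finset.univ.filter fun σ : ι → Bool => u < |∑ i, sgn (σ i) * f i|).card : ℝ)
      ≤ 2 ^ Fintype.card ι * (2 * Real.exp (-(u ^ 2 / (2 * v)))) := by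
  have h1 := card_sgn_sum_gt_le f hv hf hu
  have h2 := card_sgn_sum_gt_le (fun i => -f i) hv (by simpa using hf) hu
  have hsub : (Finset.univ.filter fun σ : ι → Bool => u < |∑ i, sgn (σ i) * f i|) ⊆
      (Finset.univ.filter fun σ : ι → Bool => u < ∑ i, sgn (σ i) * f i) ∪
      (Finset.univ.filter fun σ : ι → Bool => u < ∑ i, sgn (σ i) * -f i) := by
    intro σ hσ
    have hσ := (Finset.mem_filter.1 hσ).2
    simp only [Finset.mem_union, Finset.mem_filter, Finset.mem_univ, true_and, mul_neg,
      Finset.sum_neg_distrib]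
    exact lt_abs.1 hσ
  have h3 := (Finset.card_le_card hsub).trans (Finset.card_union_le _ _)
  have h3' : ((Finset.univ.filter fun σ : ι → Bool => u < |∑ i, sgn (σ i) * f i|).card : ℝ) ≤
      (Finset.univ.filter fun σ : ι → Bool => u < ∑ i, sgn (σ i) * f i).card +
      (Finset.univ.filter fun σ : ι → Bool => u < ∑ i, sgn (σ i) * -f i).card := by
    exact_mod_cast h3
  linarith

end Signs

/-! ### Chaining for families of sets in a product. -/

section Chaining

variable {ι κ : Type*} [DecidableEq ι] [Fintype κ] [DecidableEq κ]

/-- The proportion of the fibre of `A` over each point. -/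
def fibreAvg (A : Finset (ι × κ)) (i : ι) : ℝ :=
  ((Finset.univ.filter fun l : κ => (i, l) ∈ A).card : ℝ) / Fintype.card κ

theorem fibreAvg_nonneg (A : Finset (ι × κ)) (i : ι) : 0 ≤ fibreAvg A i := by
  unfold fibreAvg; positivity

theorem fibreAvg_le_one (A : Finset (ι × κ)) (i : ι) : fibreAvg A i ≤ 1 := by
  unfold fibreAvg
  refine div_le_one_of_le₀ ?_ (Nat.cast_nonneg _)
  exact_mod_cast Finset.card_le_univ _

theorem fibreAvg_le_add (A B : Finset (ι × κ)) (i : ι) :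
    fibreAvg A i ≤ fibreAvg B i + fibreAvg (symmDiff A B) i := by
  unfold fibreAvg
  rw [← add_div]
  gcongr
  have : (Finset.univ.filter fun l : κ => (i, l) ∈ A) ⊆
      (Finset.univ.filter fun l : κ => (i, l) ∈ B) ∪
        (Finset.univ.filter fun l : κ => (i, l) ∈ symmDiff A B) := by
    intro l hl
    simp only [Finset.mem_union, Finset.mem_filter, Finset.mem_univ, true_and,
      Finset.mem_symmDiff] at hl ⊢
    tauto
  exact_mod_cast (Finset.card_le_card this).trans (Finset.card_union_le _ _)

variable [Fintype ι]

theorem sum_fibreAvg (A : Finset (ι × κ)) :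
    ∑ i, fibreAvg A i = (A.card : ℝ) / Fintype.card κ := by
  unfold fibreAvg
  rw [← Finset.sum_div]
  congr 1
  rw [← Nat.cast_sum]
  congr 1
  rw [Finset.card_eq_sum_card_fiberwise (f := Prod.fst) (t := Finset.univ) (by simp)]
  refine Finset.sum_congr rfl fun i _ => ?_
  refine Finset.card_bij (fun l _ => (i, l)) ?_ ?_ ?_
  · intro l hl
    simpa using hl
  · intro l _ l' _ h
    exact (Prod.mk.inj h).2
  · rintro ⟨i', l⟩ h
    simp only [Finset.mem_filter] at h
    obtain ⟨h, rfl⟩ := h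
    exact ⟨l, by simpa using h, rfl⟩

/-- The fibre proportions of the symmetric difference lie in [0, 1], so their squares are no larger
than themselves. Nets in cardinality thus become nets in ℓ². -/
theorem sum_sq_fibreAvg_sub_le (A B : Finset (ι × κ)) :
    ∑ i, (fibreAvg A i - fibreAvg B i) ^ 2 ≤ ((symmDiff A B).card : ℝ) / Fintype.card κ := by
  rw [← sum_fibreAvg]
  refine Finset.sum_le_sum fun i _ => ?_
  have h1 := fibreAvg_le_add A B i
  have h2 := fibreAvg_le_add B A i
  rw [symmDiff_comm] at h2
  have h3 := fibreAvg_nonneg (symmDiff A B) i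
  have h4 := fibreAvg_le_one (symmDiff A B) i
  have h5 : (fibreAvg A i - fibreAvg B i) ^ 2 ≤ fibreAvg (symmDiff A B) i ^ 2 :=
    sq_le_sq' (by linarith) (by linarith)
  nlinarith

theorem sum_sq_fibreAvg_le (A : Finset (ι × κ)) :
    ∑ i, fibreAvg A i ^ 2 ≤ Fintype.card ι := by
  calc ∑ i, fibreAvg A i ^ 2 ≤ ∑ _i : ι, (1 : ℝ) := by
        refine Finset.sum_le_sum fun i _ => ?_
        have := fibreAvg_nonneg A i
        have := fibreAvg_le_one A i
        nlinarith
    _ = _ := by simp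

theorem card_exists_abs_sgn_sum_gt_le {α : Type*} (𝒬 : Finset α) (f : α → ι → ℝ) {v u : ℝ}
    (hv : 0 < v) (hf : ∀ q ∈ 𝒬, ∑ i, f q i ^ 2 ≤ v) (hu : 0 ≤ u) :
    ((Finset.univ.filter fun σ : ι → Bool =>
        ∃ q ∈ 𝒬, u < |∑ i, sgn (σ i) * f q i|).card : ℝ)
      ≤ 𝒬.card * (2 ^ Fintype.card ι * (2 * Real.exp (-(u ^ 2 / (2 * v))))) := by
  classical
  have hsub : (Finset.univ.filter fun σ : ι → Bool =>
      ∃ q ∈ 𝒬, u < |∑ i, sgn (σ i) * f q i|) ⊆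
      𝒬.biUnion fun q => Finset.univ.filter fun σ : ι → Bool => u < |∑ i, sgn (σ i) * f q i| := by
    intro σ hσ
    simpa using hσ
  have h : ((Finset.univ.filter fun σ : ι → Bool =>
        ∃ q ∈ 𝒬, u < |∑ i, sgn (σ i) * f q i|).card : ℝ) ≤
      ∑ q ∈ 𝒬, ((Finset.univ.filter fun σ : ι → Bool =>
        u < |∑ i, sgn (σ i) * f q i|).card : ℝ) := by
    exact_mod_cast (Finset.card_le_card hsub).trans Finset.card_biUnion_le
  refine h.trans ((Finset.sum_le_sum fun q hq =>
    card_abs_sgn_sum_gt_le (f q) hv (hf q hq) hu).trans ?_)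
  rw [Finset.sum_const, nsmul_eq_mul]

/-- The union bound at level k: the net has at most 2·16^((k+1)d) ≤ 2e^(3d(k+1)) members. The
exponent cancels this count and leaves e^(-s) times a summable geometric factor. -/
theorem level_weight_le (d k : ℕ) {s N e : ℝ} (hs : 0 ≤ s)
    (hN : N ≤ 2 * (4 / (1 / 4 : ℝ) ^ k) ^ (2 * d))
    (he : (k + 1) * (3 * d + s + 1) ≤ e) :
    N * (2 * Real.exp (-e)) ≤ 4 * Real.exp (-s) * (1 / 2) ^ (k + 1) := by
  have hexp : (2 : ℝ) ≤ Real.exp 1 := by linarith [Real.exp_one_gt_d9]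
  have h16 : (16 : ℝ) ≤ Real.exp 3 := by
    have h : Real.exp 3 = Real.exp 1 ^ 3 := by rw [← Real.exp_nat_mul]; norm_num
    rw [h]
    calc (16 : ℝ) ≤ 2.7 ^ 3 := by norm_num
      _ ≤ _ := by
        gcongr
        linarith [Real.exp_one_gt_d9]
  have h1 : (4 / (1 / 4 : ℝ) ^ k) ^ (2 * d) ≤ Real.exp ((k + 1) * (3 * d)) := by
    calc (4 / (1 / 4 : ℝ) ^ k) ^ (2 * d) = 16 ^ ((k + 1) * d) := by
          rw [one_div, inv_pow, div_inv_eq_mul, ← pow_succ', ← pow_mul,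
            show (16 : ℝ) = 4 ^ 2 by norm_num, ← pow_mul]
          congr 1
          ring
      _ ≤ Real.exp 3 ^ ((k + 1) * d) := by gcongr
      _ = _ := by
          rw [← Real.exp_nat_mul]
          congr 1
          push_cast
          ring
  have h2 : Real.exp (-e) ≤ Real.exp (-((k + 1) * (3 * d))) * Real.exp (-s)
      * Real.exp (-1) ^ (k + 1) := by
    rw [← Real.exp_nat_mul, ← Real.exp_add, ← Real.exp_add]
    refine Real.exp_le_exp.2 ?_
    push_cast
    have : 0 ≤ k * s := by positivity
    nlinarith
  have h3 : Real.exp (-1) ≤ 1 / 2 := by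
    rw [Real.exp_neg, one_div]
    exact inv_anti₀ (by norm_num) hexp
  calc N * (2 * Real.exp (-e))
      ≤ (2 * Real.exp ((k + 1) * (3 * d))) * (2 * (Real.exp (-((k + 1) * (3 * d)))
        * Real.exp (-s) * (1 / 2) ^ (k + 1))) := by
        refine mul_le_mul (hN.trans (by gcongr)) ?_ (by positivity) (by positivity)
        gcongr
        exact h2.trans (by gcongr)
    _ = (Real.exp ((k + 1) * (3 * d)) * Real.exp (-((k + 1) * (3 * d)))) *
        (4 * Real.exp (-s) * (1 / 2) ^ (k + 1)) := by ring
    _ = _ := by rw [← Real.exp_add]; simp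

theorem sum_range_succ_mul_half_pow (k : ℕ) :
    ∑ j ∈ Finset.range k, ((j : ℝ) + 1) * (1 / 2) ^ j = 4 - (2 * k + 4) * (1 / 2) ^ k := by
  induction k with
  | zero => norm_num
  | succ k ih => rw [Finset.sum_range_succ, ih, pow_succ]; push_cast; ring

theorem sum_range_half_pow_succ (k : ℕ) :
    ∑ j ∈ Finset.range k, (1 / 2 : ℝ) ^ (j + 1) = 1 - (1 / 2) ^ k := by
  induction k with
  | zero => norm_num
  | succ k ih => rw [Finset.sum_range_succ, ih, pow_succ]; ring

/-- Chaining bound for the Rademacher process indexed by a family of sets of bounded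
VC-dimension. -/
theorem card_exists_sgn_fibreAvg_gt_le [Nonempty ι] [Nonempty κ]
    (𝒜 : Finset (Finset (ι × κ))) {d : ℕ} (hd : ∀ s, 𝒜.Shatters s → s.card ≤ d)
    {s : ℝ} (hs : 0 ≤ s) :
    ((Finset.univ.filter fun σ : ι → Bool => ∃ A ∈ 𝒜,
        4 * √(8 * Fintype.card ι * (3 * d + s + 1)) < |∑ i, sgn (σ i) * fibreAvg A i|).card : ℝ)
      ≤ 2 ^ Fintype.card ι * (4 * Real.exp (-s)) := by
  classical
  set n : ℝ := (Fintype.card ι : ℝ) with hn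
  have hnpos : 0 < n := by rw [hn]; exact_mod_cast Fintype.card_pos
  have hκpos : (0 : ℝ) < Fintype.card κ := by exact_mod_cast Fintype.card_pos
  set U := √(8 * n * (3 * d + s + 1)) with hU
  have hU0 : 0 ≤ U := Real.sqrt_nonneg _
  have hUsq : U ^ 2 = 8 * n * (3 * d + s + 1) := Real.sq_sqrt (by positivity)
  have hη : ∀ k : ℕ, (0 : ℝ) < (1 / 4) ^ k := fun k => by positivity
  have hη1 : ∀ k : ℕ, ((1 : ℝ) / 4) ^ k ≤ 1 := fun k => pow_le_one₀ (by norm_num) (by norm_num)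
  choose ℬ hℬ𝒜 hℬcard hℬnet using fun k => exists_net 𝒜 hd (hη k) (hη1 k)
  have hnet : ∀ k A, ∃ B, A ∈ 𝒜 → B ∈ ℬ k ∧
      ((symmDiff A B).card : ℝ) < (1 / 4) ^ k * Fintype.card (ι × κ) := by
    intro k A
    by_cases hA : A ∈ 𝒜
    · obtain ⟨B, hB, h⟩ := hℬnet k A hA
      exact ⟨B, fun _ => ⟨hB, h⟩⟩
    · exact ⟨∅, fun h => absurd h hA⟩
  choose π hπ using hnet
  -- At this scale a net point is at distance less than 1, hence equal to the set it approximates,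
  -- and the chain ends exactly.
  obtain ⟨K, hK⟩ : ∃ K : ℕ, (1 / 4 : ℝ) ^ K * Fintype.card (ι × κ) ≤ 1 := by
    obtain ⟨K, hK⟩ := exists_pow_lt_of_lt_one (show (0 : ℝ) < 1 / Fintype.card (ι × κ) by
      rw [Fintype.card_prod]; push_cast; positivity) (show (1 / 4 : ℝ) < 1 by norm_num)
    refine ⟨K, ?_⟩
    rw [lt_div_iff₀ (by rw [Fintype.card_prod]; push_cast; positivity)] at hK
    exact hK.le
  have hπK : ∀ A ∈ 𝒜, A ∈ ℬ K := by
    intro A hA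
    obtain ⟨h1, h2⟩ := hπ K A hA
    have : (symmDiff A (π K A)).card = 0 := by
      have : ((symmDiff A (π K A)).card : ℝ) < 1 := h2.trans_le hK
      have : (symmDiff A (π K A)).card < 1 := by exact_mod_cast this
      omega
    rw [Finset.card_eq_zero, ← Finset.bot_eq_empty, symmDiff_eq_bot] at this
    rwa [this]
  -- the increments of the chain
  let f : ℕ → Finset (ι × κ) → ι → ℝ := fun k A i =>
    match k with
    | 0 => fibreAvg A i
    | k + 1 => fibreAvg A i - fibreAvg (π k A) i
  -- The weights (k+1)2^(-k) sum to less than 4, the constant in the conclusion. The increment at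
  -- level k ≥ 1 has variance at most 4^(-(k-1))n, so its tail exponent is (k+1)²(3d+s+1).
  let u : ℕ → ℝ := fun k => (k + 1) * (1 / 2) ^ k * U
  let E : ℕ → Finset (ι → Bool) := fun k => Finset.univ.filter fun σ : ι → Bool =>
    ∃ A ∈ ℬ k, u k < |∑ i, sgn (σ i) * f k A i|
  have hu0 : ∀ k, 0 ≤ u k := fun k => by positivity
  have hE : ∀ k, ((E k).card : ℝ) ≤
      2 ^ Fintype.card ι * (4 * Real.exp (-s) * (1 / 2) ^ (k + 1)) := by
    intro k
    have hd0 : (0 : ℝ) ≤ 3 * d + s + 1 := by positivity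
    cases k with
    | zero =>
      refine (card_exists_abs_sgn_sum_gt_le (ℬ 0) (f 0) hnpos
        (fun q _ => sum_sq_fibreAvg_le q) (hu0 0)).trans ?_
      rw [mul_left_comm]
      refine mul_le_mul_of_nonneg_left (level_weight_le d 0 hs (hℬcard 0) ?_) (by positivity)
      have : u 0 ^ 2 / (2 * n) = 4 * (3 * d + s + 1) := by
        simp only [u, Nat.cast_zero, zero_add, pow_zero, one_mul]
        rw [hUsq]
        field_simp
        ring
      rw [this]
      push_cast
      linarith
    | succ k =>
      refine (card_exists_abs_sgn_sum_gt_le (ℬ (k + 1)) (f (k + 1))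
        (v := (1 / 4) ^ k * n) (by positivity) (fun q hq => ?_) (hu0 (k + 1))).trans ?_
      · refine (sum_sq_fibreAvg_sub_le q (π k q)).trans ?_
        rw [div_le_iff₀ hκpos]
        refine (hπ k q (hℬ𝒜 _ hq)).2.le.trans (le_of_eq ?_)
        rw [Fintype.card_prod]
        push_cast
        ring
      · rw [mul_left_comm]
        refine mul_le_mul_of_nonneg_left
          (level_weight_le d (k + 1) hs (hℬcard (k + 1)) ?_) (by positivity)
        have h4 : ((1 / 2 : ℝ) ^ (k + 1)) ^ 2 = (1 / 4) ^ k * (1 / 4) := by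
          rw [← pow_succ, ← pow_mul, mul_comm, pow_mul]
          norm_num
        have : u (k + 1) ^ 2 / (2 * ((1 / 4) ^ k * n))
            = (((k + 1 : ℕ) : ℝ) + 1) ^ 2 * (3 * d + s + 1) := by
          simp only [u]
          rw [mul_pow, mul_pow, hUsq, h4]
          field_simp
          ring
        rw [this]
        gcongr
        push_cast
        nlinarith [(Nat.cast_nonneg k : (0 : ℝ) ≤ k)]
  -- Each chain projects the current net point, not the original set. The increment at level k is
  -- therefore determined by a member of `ℬ k`, and the union bound runs over that net only.
  have hchain : ∀ (σ : ι → Bool) (k : ℕ), (∀ j ≤ k, σ ∉ E j) → ∀ A ∈ ℬ k,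
      |∑ i, sgn (σ i) * fibreAvg A i| ≤ ∑ j ∈ Finset.range (k + 1), u j := by
    intro σ k
    induction k with
    | zero =>
      intro h A hA
      have := h 0 le_rfl
      simp only [E, Finset.mem_filter, Finset.mem_univ, true_and, not_exists, not_and, not_lt] at this
      simpa using this A hA
    | succ k ih =>
      intro h A hA
      have h1 := h (k + 1) le_rfl
      simp only [E, Finset.mem_filter, Finset.mem_univ, true_and, not_exists, not_and, not_lt] at h1
      have h2 := h1 A hA
      have h3 := ih (fun j hj => h j (by omega)) (π k A) (hπ k A (hℬ𝒜 _ hA)).1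
      rw [Finset.sum_range_succ]
      have h4 : ∑ i, sgn (σ i) * fibreAvg A i = ∑ i, sgn (σ i) * fibreAvg (π k A) i
          + ∑ i, sgn (σ i) * f (k + 1) A i := by
        rw [← Finset.sum_add_distrib]
        refine Finset.sum_congr rfl fun i _ => ?_
        simp only [f]
        ring
      rw [h4]
      exact (abs_add_le _ _).trans (add_le_add h3 h2)
  have hsub : (Finset.univ.filter fun σ : ι → Bool => ∃ A ∈ 𝒜,
      4 * U < |∑ i, sgn (σ i) * fibreAvg A i|) ⊆ (Finset.range (K + 1)).biUnion E := by
    intro σ hσ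
    obtain ⟨A, hA, hgt⟩ := (Finset.mem_filter.1 hσ).2
    by_contra hnot
    simp only [Finset.mem_biUnion, Finset.mem_range, not_exists, not_and] at hnot
    have h1 := hchain σ K (fun j hj => hnot j (by omega)) A (hπK A hA)
    have h2 : ∑ j ∈ Finset.range (K + 1), u j ≤ 4 * U := by
      simp only [u]
      rw [← Finset.sum_mul, sum_range_succ_mul_half_pow]
      gcongr
      have : (0 : ℝ) ≤ (2 * ((K + 1 : ℕ) : ℝ) + 4) * (1 / 2) ^ (K + 1) := by positivity
      linarith
    linarith
  have hcard : ((Finset.univ.filter fun σ : ι → Bool => ∃ A ∈ 𝒜,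
      4 * U < |∑ i, sgn (σ i) * fibreAvg A i|).card : ℝ) ≤
        ∑ k ∈ Finset.range (K + 1), ((E k).card : ℝ) := by
    exact_mod_cast (Finset.card_le_card hsub).trans Finset.card_biUnion_le
  refine hcard.trans ((Finset.sum_le_sum fun k _ => hE k).trans ?_)
  rw [← Finset.mul_sum, ← Finset.mul_sum, sum_range_half_pow_succ]
  have : (0 : ℝ) < (1 / 2) ^ (K + 1) := by positivity
  have h4 : 4 * Real.exp (-s) * (1 - (1 / 2) ^ (K + 1)) ≤ 4 * Real.exp (-s) :=
    mul_le_of_le_one_right (by positivity) (by linarith)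
  gcongr

end Chaining

/-! ### From bounded functions to sets on a grid. -/

section Discretization

variable {Z : Type*}

theorem abs_card_levels_div_sub_le {n : ℕ} (hn : 0 < n) {x : ℝ} (hx0 : 0 ≤ x) (hx1 : x ≤ n) :
    |((Finset.univ.filter fun l : Fin n => (l : ℝ) < x).card : ℝ) / n - x / n| ≤ 1 / n := by
  have hn' : (0 : ℝ) < n := by exact_mod_cast hn
  have hcard : (Finset.univ.filter fun l : Fin n => (l : ℝ) < x).card = ⌈x⌉₊ := by
    have h1 : (Finset.univ.filter fun l : Fin n => (l : ℝ) < x).card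
        = ((Finset.univ.filter fun l : Fin n => (l : ℝ) < x).image fun l : Fin n => (l : ℕ)).card :=
      (Finset.card_image_of_injective _ Fin.val_injective).symm
    rw [h1, ← Finset.card_range ⌈x⌉₊]
    congr 1
    ext k
    simp only [Finset.mem_image, Finset.mem_filter, Finset.mem_univ, true_and, Finset.mem_range,
      Nat.lt_ceil]
    constructor
    · rintro ⟨l, hl, rfl⟩
      exact hl
    · intro hk
      exact ⟨⟨k, by exact_mod_cast hk.trans_le hx1⟩, hk, rfl⟩
  rw [hcard, ← sub_div, abs_div, abs_of_pos hn']
  gcongr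
  rw [abs_of_nonneg (sub_nonneg.2 (Nat.le_ceil x))]
  linarith [Nat.ceil_lt_add_one hx0]

/-- The sub-level pairs of `g` on the sample `z`, with `n` equally spaced levels in `[0, M]`. -/
def levelSet {n : ℕ} (M : ℝ) (z : Fin n → Z) (g : Z → ℝ) : Finset (Fin n × Fin n) :=
  Finset.univ.filter fun q => (q.2 : ℝ) * M < n * g (z q.1)

/-- A function above a level is above all lower ones, so a shattered set has at most one level over
each sample value. These levels serve as the thresholds of pseudo-shattering. -/
theorem card_le_of_shatters_levelSet {n : ℕ} {M : ℝ} (hM : 0 < M) (z : Fin n → Z)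
    {G : Set (Z → ℝ)} {d : ℕ} (hd : ∀ s, PseudoShatters G s → s.card ≤ d)
    (𝒜 : Finset (Finset (Fin n × Fin n))) (h𝒜 : ∀ A ∈ 𝒜, ∃ g ∈ G, A = levelSet M z g)
    {I : Finset (Fin n × Fin n)} (hI : 𝒜.Shatters I) : I.card ≤ d := by
  classical
  have key : ∀ J ⊆ I, ∃ g ∈ G, ∀ q ∈ I, ((q.2 : ℝ) * M < n * g (z q.1) ↔ q ∈ J) := by
    intro J hJ
    obtain ⟨A, hA, hAJ⟩ := hI hJ
    obtain ⟨g, hg, rfl⟩ := h𝒜 A hA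
    refine ⟨g, hg, fun q hq => ?_⟩
    rw [← hAJ]
    simp [levelSet, hq]
  have hinj : Set.InjOn (fun q : Fin n × Fin n => z q.1) I := by
    have aux : ∀ q ∈ I, ∀ q' ∈ I, z q.1 = z q'.1 → q.2 ≤ q'.2 → q = q' := by
      intro q hq q' hq' hz hle
      obtain ⟨g, -, hg⟩ := key {q'} (by simpa using hq')
      have h1 := (hg q' hq').2 (by simp)
      rw [← hz] at h1
      have h2 : (q.2 : ℝ) * M ≤ (q'.2 : ℝ) * M := by
        gcongr
        exact_mod_cast hle
      exact Finset.mem_singleton.1 ((hg q hq).1 (h2.trans_lt h1))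
    intro q hq q' hq' hz
    rcases le_total q.2 q'.2 with h | h
    · exact aux q hq q' hq' hz h
    · exact (aux q' hq' q hq hz.symm h).symm
  rw [← Finset.card_image_of_injOn hinj]
  refine hd _ ?_
  have ht : ∀ x : Z, ∃ t : ℝ, ∀ q ∈ I, z q.1 = x → t = (q.2 : ℝ) * M / n := by
    intro x
    by_cases hx : ∃ q ∈ I, z q.1 = x
    · obtain ⟨q, hq, hqx⟩ := hx
      refine ⟨(q.2 : ℝ) * M / n, fun q' hq' hqx' => ?_⟩
      rw [hinj hq hq' (hqx.trans hqx'.symm)]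
    · exact ⟨0, fun q hq hqx => absurd ⟨q, hq, hqx⟩ hx⟩
  choose t ht using ht
  refine ⟨t, fun u hu => ?_⟩
  obtain ⟨g, hg, hgI⟩ := key (I.filter fun q => z q.1 ∈ u) (Finset.filter_subset _ _)
  refine ⟨g, hg, fun x hx => ?_⟩
  obtain ⟨q, hq, rfl⟩ := Finset.mem_image.1 hx
  have hn : (0 : ℝ) < n := by exact_mod_cast (Fin.pos q.1)
  rw [ht _ q hq rfl, div_lt_iff₀' hn, hgI q hq, Finset.mem_filter]
  exact ⟨fun h => ⟨hq, h⟩, fun h => h.2⟩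

/-- Tail bound for the Rademacher process indexed by a class of bounded pseudo-dimension. -/
theorem card_exists_sgn_sum_gt_le {G : Set (Z → ℝ)} {d : ℕ}
    (hd : ∀ s, PseudoShatters G s → s.card ≤ d) {M : ℝ} (hM : 0 ≤ M)
    (hG : ∀ g ∈ G, ∀ x, 0 ≤ g x ∧ g x ≤ M) {n : ℕ} (hn : 0 < n) (z : Fin n → Z)
    {s : ℝ} (hs : 0 ≤ s) (T : Finset (Fin n → Bool))
    (hT : ∀ σ ∈ T, ∃ g ∈ G,
      5 * M * √(8 * n * (3 * d + s + 1)) < |∑ i, sgn (σ i) * g (z i)|) :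
    (T.card : ℝ) ≤ 2 ^ n * (4 * Real.exp (-s)) := by
  classical
  have : Nonempty (Fin n) := ⟨⟨0, hn⟩⟩
  have hn' : (0 : ℝ) < n := by exact_mod_cast hn
  rcases hM.eq_or_lt with rfl | hMpos
  · have : T = ∅ := by
      refine Finset.eq_empty_of_forall_notMem fun σ hσ => ?_
      obtain ⟨g, hg, h⟩ := hT σ hσ
      have h0 : ∀ x, g x = 0 := fun x => le_antisymm (hG g hg x).2 (hG g hg x).1
      simp [h0] at h
    rw [this]
    simp
    positivity
  set 𝒜 : Finset (Finset (Fin n × Fin n)) :=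
    Finset.univ.filter fun A => ∃ g ∈ G, A = levelSet M z g
  have hvc : ∀ I, 𝒜.Shatters I → I.card ≤ d := fun I hI =>
    card_le_of_shatters_levelSet hMpos z hd 𝒜 (fun A hA => (Finset.mem_filter.1 hA).2) hI
  have h := card_exists_sgn_fibreAvg_gt_le 𝒜 hvc hs
  rw [Fintype.card_fin] at h
  refine le_trans ?_ h
  refine Nat.cast_le.2 (Finset.card_le_card fun σ hσ => ?_)
  obtain ⟨g, hg, hgt⟩ := hT σ hσ
  refine Finset.mem_filter.2 ⟨Finset.mem_univ _, levelSet M z g,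
    Finset.mem_filter.2 ⟨Finset.mem_univ _, g, hg, rfl⟩, ?_⟩
  set U := √(8 * n * (3 * d + s + 1))
  have hU1 : 1 ≤ U := by
    rw [Real.one_le_sqrt]
    have : (1 : ℝ) ≤ n := by exact_mod_cast hn
    have : (0 : ℝ) ≤ d := Nat.cast_nonneg d
    nlinarith
  have hfib : ∀ i, |fibreAvg (levelSet M z g) i - g (z i) / M| ≤ 1 / n := by
    intro i
    obtain ⟨h0, h1⟩ := hG g hg (z i)
    have h2 := abs_card_levels_div_sub_le hn (x := n * g (z i) / M) (by positivity)
      (by rw [div_le_iff₀ hMpos]; gcongr)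
    have h3 : fibreAvg (levelSet M z g) i
        = ((Finset.univ.filter fun l : Fin n => (l : ℝ) < n * g (z i) / M).card : ℝ) / n := by
      unfold fibreAvg
      rw [Fintype.card_fin]
      congr 3
      ext l
      simp [levelSet, lt_div_iff₀ hMpos]
    rw [h3]
    convert h2 using 3
    field_simp
  -- Rounding to n levels moves the signed sum by at most n·(1/n) = 1 ≤ U, which raises the constant
  -- from 4 to 5.
  have hdiff : |∑ i, sgn (σ i) * (g (z i) / M) - ∑ i, sgn (σ i) * fibreAvg (levelSet M z g) i|
      ≤ 1 := by
    rw [← Finset.sum_sub_distrib]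
    refine (Finset.abs_sum_le_sum_abs _ _).trans ?_
    calc ∑ i, |sgn (σ i) * (g (z i) / M) - sgn (σ i) * fibreAvg (levelSet M z g) i|
        ≤ ∑ _i : Fin n, (1 / n : ℝ) := by
          refine Finset.sum_le_sum fun i _ => ?_
          rw [← mul_sub, abs_mul, abs_sgn, one_mul, abs_sub_comm]
          exact hfib i
      _ = 1 := by
        rw [Finset.sum_const, Finset.card_univ, Fintype.card_fin, nsmul_eq_mul]
        field_simp
  have hgt' : 5 * U < |∑ i, sgn (σ i) * (g (z i) / M)| := by
    simp_rw [← mul_div_assoc]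
    rw [← Finset.sum_div, abs_div, abs_of_pos hMpos, lt_div_iff₀ hMpos]
    linarith
  have := abs_sub_abs_le_abs_sub (∑ i, sgn (σ i) * (g (z i) / M))
    (∑ i, sgn (σ i) * fibreAvg (levelSet M z g) i)
  linarith

end Discretization

/-! ### Ghost samples, random signs and the uniform deviation bound. -/

section Symmetrization

variable {Z : Type*} [MeasurableSpace Z]

/-- Exchange the coordinates of two samples where the sign is negative. -/
def swapSigns {n : ℕ} (σ : Fin n → Bool) (q : (Fin n → Z) × (Fin n → Z)) :
    (Fin n → Z) × (Fin n → Z) :=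
  (fun i => if σ i then q.1 i else q.2 i, fun i => if σ i then q.2 i else q.1 i)

theorem measurePreserving_swapSigns {n : ℕ} (σ : Fin n → Bool) (D : Measure Z)
    [IsProbabilityMeasure D] :
    MeasurePreserving (swapSigns σ)
      ((Measure.pi fun _ : Fin n => D).prod (Measure.pi fun _ : Fin n => D))
      ((Measure.pi fun _ : Fin n => D).prod (Measure.pi fun _ : Fin n => D)) := by
  have h1 := measurePreserving_arrowProdEquivProdArrow Z Z (Fin n) (fun _ => D) (fun _ => D)
  have h2 : MeasurePreserving (fun (a : Fin n → Z × Z) i => if σ i then a i else (a i).swap)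
      (Measure.pi fun _ => D.prod D) (Measure.pi fun _ => D.prod D) := by
    refine measurePreserving_pi (fun _ => D.prod D) (fun _ => D.prod D)
      (f := fun i q => if σ i then q else q.swap) fun i => ?_
    cases σ i
    · simpa using Measure.measurePreserving_swap
    · exact MeasurePreserving.id _
  have h3 := h1.comp (h2.comp h1.symm)
  convert h3 using 1
  funext q
  refine Prod.ext (funext fun i => ?_) (funext fun i => ?_)
  · show (if σ i then q.1 i else q.2 i) = (if σ i then (q.1 i, q.2 i) else (q.2 i, q.1 i)).1
    split_ifs <;> rfl
  · show (if σ i then q.2 i else q.1 i) = (if σ i then (q.1 i, q.2 i) else (q.2 i, q.1 i)).2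
    split_ifs <;> rfl

/-- Chebyshev's inequality, with variance at most M²/4 for a variable in [0, M]. It keeps the ghost
sample near its mean half of the time. -/
theorem half_le_measure_abs_sum_sub_lt {D : Measure Z} [IsProbabilityMeasure D] {g : Z → ℝ}
    (hg : Measurable g) {M : ℝ} (hM : ∀ x, 0 ≤ g x ∧ g x ≤ M) {n : ℕ} {c : ℝ} (hc : 0 < c)
    (hnc : n * M ^ 2 ≤ 2 * c ^ 2) :
    1 / 2 ≤ (Measure.pi fun _ : Fin n => D) {z | |∑ i, g (z i) - n * ∫ x, g x ∂D| < c} := by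
  set Q := Measure.pi fun _ : Fin n => D
  have hmem : MemLp g 2 D := MemLp.of_bound hg.aestronglyMeasurable M
    (Filter.Eventually.of_forall fun x => by
      rw [Real.norm_eq_abs, abs_of_nonneg (hM x).1]; exact (hM x).2)
  have hmemi : ∀ i : Fin n, MemLp (fun z : Fin n → Z => g (z i)) 2 Q := fun i =>
    hmem.comp_measurePreserving (measurePreserving_eval (fun _ : Fin n => D) i)
  have hX : MemLp (∑ i : Fin n, fun z : Fin n → Z => g (z i)) 2 Q :=
    memLp_finsetSum' _ fun i _ => hmemi i
  have hvar : Var[∑ i : Fin n, fun z : Fin n → Z => g (z i); Q] ≤ n * (M / 2) ^ 2 := by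
    rw [variance_sum_pi (μ := fun _ : Fin n => D) (X := fun _ => g) fun _ => hmem]
    have : Var[g; D] ≤ (M / 2) ^ 2 := by
      have := variance_le_sq_of_bounded (μ := D) (a := 0) (b := M)
        (Filter.Eventually.of_forall fun x => ⟨(hM x).1, (hM x).2⟩) hg.aemeasurable
      simpa using this
    calc ∑ _i : Fin n, Var[g; D] ≤ ∑ _i : Fin n, (M / 2) ^ 2 := Finset.sum_le_sum fun _ _ => this
      _ = _ := by simp
  have hmean : Q[∑ i : Fin n, fun z : Fin n → Z => g (z i)] = n * ∫ x, g x ∂D := by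
    simp only [Finset.sum_apply]
    rw [integral_finsetSum _ fun i _ => (hmemi i).integrable one_le_two]
    have : ∀ i : Fin n, ∫ z, g (z i) ∂Q = ∫ x, g x ∂D := fun i => by
      have h := measurePreserving_eval (fun _ : Fin n => D) i
      rw [← h.map_eq, integral_map h.measurable.aemeasurable
        hg.aestronglyMeasurable]
    simp [this]
  have hcheb := meas_ge_le_variance_div_sq hX hc
  rw [hmean] at hcheb
  have hle : Q {z | c ≤ |∑ i, g (z i) - n * ∫ x, g x ∂D|} ≤ 1 / 2 := by
    have h1 : Var[∑ i : Fin n, fun z : Fin n → Z => g (z i); Q] / c ^ 2 ≤ 1 / 2 := by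
      rw [div_le_iff₀ (by positivity)]
      nlinarith
    calc Q {z | c ≤ |∑ i, g (z i) - n * ∫ x, g x ∂D|} ≤ _ := by simpa using hcheb
      _ ≤ ENNReal.ofReal (1 / 2) := ENNReal.ofReal_le_ofReal h1
      _ = 1 / 2 := by rw [ENNReal.ofReal_div_of_pos two_pos]; simp
  have hms : MeasurableSet {z : Fin n → Z | c ≤ |∑ i, g (z i) - n * ∫ x, g x ∂D|} :=
    measurableSet_le measurable_const (by fun_prop)
  have hcompl : {z : Fin n → Z | |∑ i, g (z i) - n * ∫ x, g x ∂D| < c}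
      = {z : Fin n → Z | c ≤ |∑ i, g (z i) - n * ∫ x, g x ∂D|}ᶜ := by
    ext z; simp
  rw [hcompl, prob_compl_eq_one_sub hms]
  have : (1 / 2 : ℝ≥0∞) = 1 - 1 / 2 := by simp
  rw [this]
  exact tsub_le_tsub_left hle 1

/-- If most ghost samples put a pair in `A`, then the set of samples has measure at most twice that
of `A`. -/
theorem measure_le_two_mul_prod {α β : Type*} [MeasurableSpace α] [MeasurableSpace β]
    (μ : Measure α) [SFinite μ] (ν : Measure β) [SFinite ν] {B : Set α} {A : Set (α × β)}
    (h : ∀ z ∈ B, 1 / 2 ≤ ν {w | (z, w) ∈ A}) : μ B ≤ 2 * (μ.prod ν) A := by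
  -- `A` need not be measurable; its measurable hull has the same measure and permits Markov's
  -- inequality on the sections.
  set A' := toMeasurable (μ.prod ν) A
  have hA' : MeasurableSet A' := measurableSet_toMeasurable _ _
  have h1 : B ⊆ {z | (1 / 2 : ℝ≥0∞) ≤ ν (Prod.mk z ⁻¹' A')} := fun z hz =>
    (h z hz).trans (measure_mono fun w hw => subset_toMeasurable _ _ hw)
  have h2 := mul_meas_ge_le_lintegral (μ := μ) (measurable_measure_prodMk_left (ν := ν) hA') (1 / 2)
  rw [← Measure.prod_apply hA', measure_toMeasurable] at h2
  calc μ B ≤ μ {z | (1 / 2 : ℝ≥0∞) ≤ ν (Prod.mk z ⁻¹' A')} := measure_mono h1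
    _ = 2 * (1 / 2 * μ {z | (1 / 2 : ℝ≥0∞) ≤ ν (Prod.mk z ⁻¹' A')}) := by
      rw [← mul_assoc, one_div, ENNReal.mul_inv_cancel (by simp) (by simp), one_mul]
    _ ≤ _ := by gcongr

/-- Swapping pairs preserves the joint law and turns the difference into one of two signed sums, one
of which must exceed u. As σ is arbitrary, the bound can be averaged over all signs. -/
theorem prod_exists_abs_sub_gt_le {D : Measure Z} [IsProbabilityMeasure D] (G : Set (Z → ℝ))
    {n : ℕ} (u : ℝ) (σ : Fin n → Bool) :
    ((Measure.pi fun _ : Fin n => D).prod (Measure.pi fun _ : Fin n => D))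
        {q | ∃ g ∈ G, 2 * u < |∑ i, g (q.1 i) - ∑ i, g (q.2 i)|}
      ≤ 2 * (Measure.pi fun _ : Fin n => D) {z | ∃ g ∈ G, u < |∑ i, sgn (σ i) * g (z i)|} := by
  set Q := Measure.pi fun _ : Fin n => D
  set E := {z : Fin n → Z | ∃ g ∈ G, u < |∑ i, sgn (σ i) * g (z i)|}
  set E' := toMeasurable Q E
  have hE' : MeasurableSet E' := measurableSet_toMeasurable _ _
  have hsub : {q : (Fin n → Z) × (Fin n → Z) |
      ∃ g ∈ G, 2 * u < |∑ i, g (q.1 i) - ∑ i, g (q.2 i)|} ⊆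
      swapSigns σ ⁻¹' (E' ×ˢ Set.univ ∪ Set.univ ×ˢ E') := by
    rintro q ⟨g, hg, hgt⟩
    have heq : ∑ i, g (q.1 i) - ∑ i, g (q.2 i)
        = ∑ i, sgn (σ i) * g ((swapSigns σ q).1 i) - ∑ i, sgn (σ i) * g ((swapSigns σ q).2 i) := by
      rw [← Finset.sum_sub_distrib, ← Finset.sum_sub_distrib]
      refine Finset.sum_congr rfl fun i _ => ?_
      simp only [swapSigns, sgn]
      split_ifs <;> ring
    rw [heq] at hgt
    have h := hgt.trans_le (abs_sub _ _)
    rcases lt_or_ge u |∑ i, sgn (σ i) * g ((swapSigns σ q).1 i)| with h1 | h1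
    · exact Or.inl ⟨subset_toMeasurable _ _ ⟨g, hg, h1⟩, trivial⟩
    · exact Or.inr ⟨trivial, subset_toMeasurable _ _ ⟨g, hg, by linarith⟩⟩
  have hms : MeasurableSet (E' ×ˢ Set.univ ∪ Set.univ ×ˢ E' : Set ((Fin n → Z) × (Fin n → Z))) :=
    (hE'.prod MeasurableSet.univ).union (MeasurableSet.univ.prod hE')
  refine (measure_mono hsub).trans ?_
  rw [(measurePreserving_swapSigns σ D).measure_preimage hms.nullMeasurableSet]
  refine (measure_union_le _ _).trans ?_
  rw [Measure.prod_prod, Measure.prod_prod, measure_univ, mul_one, one_mul, measure_toMeasurable,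
    two_mul]

/-- The event says that the supremum, finite because losses are bounded, exceeds u. Its
measurability allows the sum over signs to pass under the integral. -/
theorem nullMeasurableSet_exists_sgn_sum_gt {D : Measure Z} {G : Set (Z → ℝ)}
    (hmeas : IsMeasurableClass G D) {M : ℝ} (hG : ∀ g ∈ G, ∀ x, 0 ≤ g x ∧ g x ≤ M) {n : ℕ}
    (u : ℝ) (σ : Fin n → Bool) :
    NullMeasurableSet {z : Fin n → Z | ∃ g ∈ G, u < |∑ i, sgn (σ i) * g (z i)|}
      (Measure.pi fun _ : Fin n => D) := by
  rcases G.eq_empty_or_nonempty with rfl | hne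
  · simp
  have : Nonempty G := hne.to_subtype
  have heq : {z : Fin n → Z | ∃ g ∈ G, u < |∑ i, sgn (σ i) * g (z i)|}
      = {z | u < ⨆ g : G, |∑ i, sgn (σ i) * g.1 (z i)|} := by
    ext z
    constructor
    · rintro ⟨g, hg, h⟩
      refine h.trans_le (le_ciSup (f := fun g : G => |∑ i, sgn (σ i) * g.1 (z i)|) ?_ ⟨g, hg⟩)
      refine ⟨∑ _i : Fin n, M, ?_⟩
      rintro _ ⟨g, rfl⟩
      refine (Finset.abs_sum_le_sum_abs _ _).trans (Finset.sum_le_sum fun i _ => ?_)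
      rw [abs_mul, abs_sgn, one_mul, abs_of_nonneg (hG g.1 g.2 _).1]
      exact (hG g.1 g.2 _).2
    · intro h
      rw [Set.mem_ofPred_eq] at h
      obtain ⟨g, hg⟩ := exists_lt_of_lt_ciSup h
      exact ⟨g.1, g.2, hg⟩
  rw [heq]
  exact nullMeasurableSet_lt aemeasurable_const (hmeas.2 n fun i => sgn (σ i))

theorem sum_measure_exists_sgn_sum_gt_le {D : Measure Z} [IsProbabilityMeasure D]
    {G : Set (Z → ℝ)} {d : ℕ} (hd : ∀ s, PseudoShatters G s → s.card ≤ d) {M : ℝ} (hM : 0 ≤ M)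
    (hG : ∀ g ∈ G, ∀ x, 0 ≤ g x ∧ g x ≤ M) (hmeas : IsMeasurableClass G D) {n : ℕ} (hn : 0 < n)
    {s : ℝ} (hs : 0 ≤ s) :
    ∑ σ : Fin n → Bool, (Measure.pi fun _ : Fin n => D)
        {z | ∃ g ∈ G, 5 * M * √(8 * n * (3 * d + s + 1)) < |∑ i, sgn (σ i) * g (z i)|}
      ≤ 2 ^ n * ENNReal.ofReal (4 * Real.exp (-s)) := by
  classical
  set Q := Measure.pi fun _ : Fin n => D
  set E : (Fin n → Bool) → Set (Fin n → Z) := fun σ =>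
    {z | ∃ g ∈ G, 5 * M * √(8 * n * (3 * d + s + 1)) < |∑ i, sgn (σ i) * g (z i)|}
  have hE : ∀ σ, NullMeasurableSet (E σ) Q := fun σ =>
    nullMeasurableSet_exists_sgn_sum_gt hmeas hG _ σ
  have h1 : ∑ σ, Q (E σ) = ∫⁻ z, ∑ σ, (E σ).indicator 1 z ∂Q := by
    have hae : ∀ σ ∈ Finset.univ, AEMeasurable ((E σ).indicator (1 : (Fin n → Z) → ℝ≥0∞)) Q :=
      fun σ _ => AEMeasurable.indicator₀ (f := 1) aemeasurable_const (hE σ)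
    rw [lintegral_finsetSum' _ hae]
    exact Finset.sum_congr rfl fun σ _ => (lintegral_indicator_one₀ (hE σ)).symm
  rw [show ∑ σ : Fin n → Bool, Q {z | ∃ g ∈ G, 5 * M * √(8 * n * (3 * d + s + 1))
    < |∑ i, sgn (σ i) * g (z i)|} = ∑ σ, Q (E σ) from rfl, h1]
  calc ∫⁻ z, ∑ σ, (E σ).indicator 1 z ∂Q
      ≤ ∫⁻ _z, 2 ^ n * ENNReal.ofReal (4 * Real.exp (-s)) ∂Q := by
        refine lintegral_mono fun z => ?_
        have h2 := card_exists_sgn_sum_gt_le hd hM hG hn z hs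
          (Finset.univ.filter fun σ => z ∈ E σ) fun σ hσ => (Finset.mem_filter.1 hσ).2
        have h3 : ∑ σ, (E σ).indicator (1 : (Fin n → Z) → ℝ≥0∞) z
            = ((Finset.univ.filter fun σ => z ∈ E σ).card : ℝ≥0∞) := by
          simp [Set.indicator_apply]
        simp only [h3]
        rw [← ENNReal.ofReal_natCast]
        refine (ENNReal.ofReal_le_ofReal h2).trans (le_of_eq ?_)
        rw [ENNReal.ofReal_mul (by positivity), ENNReal.ofReal_pow (by norm_num)]
        simp
    _ = _ := by simp

/-- Uniform deviation bound at the optimal rate for a class of bounded pseudo-dimension. -/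
theorem measure_exists_abs_sum_sub_gt_le {D : Measure Z} [IsProbabilityMeasure D]
    {G : Set (Z → ℝ)} {d : ℕ} (hd : ∀ s, PseudoShatters G s → s.card ≤ d) {M : ℝ} (hM : 0 ≤ M)
    (hG : ∀ g ∈ G, ∀ x, 0 ≤ g x ∧ g x ≤ M) (hmeas : IsMeasurableClass G D) {n : ℕ} (hn : 0 < n)
    {s : ℝ} (hs : 0 ≤ s) :
    (Measure.pi fun _ : Fin n => D) {z | ∃ g ∈ G,
        20 * M * √(8 * n * (3 * d + s + 1)) < |∑ i, g (z i) - n * ∫ x, g x ∂D|}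
      ≤ ENNReal.ofReal (16 * Real.exp (-s)) := by
  set Q := Measure.pi fun _ : Fin n => D
  set U := √(8 * n * (3 * d + s + 1)) with hU
  rcases hM.eq_or_lt with rfl | hMpos
  · have : {z : Fin n → Z | ∃ g ∈ G, 20 * 0 * U < |∑ i, g (z i) - n * ∫ x, g x ∂D|} = ∅ := by
      refine Set.eq_empty_of_forall_notMem fun z hz => ?_
      obtain ⟨g, hg, h⟩ := hz
      have h0 : ∀ x, g x = 0 := fun x => le_antisymm (hG g hg x).2 (hG g hg x).1
      simp [h0] at h
    rw [this]
    simp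
  have hn' : (0 : ℝ) < n := by exact_mod_cast hn
  have hUpos : 0 < U := Real.sqrt_pos.2 (by positivity)
  have hUsq : U ^ 2 = 8 * n * (3 * d + s + 1) := Real.sq_sqrt (by positivity)
  set A : Set ((Fin n → Z) × (Fin n → Z)) :=
    {q | ∃ g ∈ G, 2 * (5 * M * U) < |∑ i, g (q.1 i) - ∑ i, g (q.2 i)|}
  have hBA : Q {z | ∃ g ∈ G, 20 * M * U < |∑ i, g (z i) - n * ∫ x, g x ∂D|}
      ≤ 2 * (Q.prod Q) A := by
    refine measure_le_two_mul_prod Q Q fun z hz => ?_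
    obtain ⟨g, hg, h⟩ := hz
    -- A deviation above 20MU on the sample and one below 10MU on the ghost sample leave a
    -- difference above 10MU = 2·5MU.
    refine (half_le_measure_abs_sum_sub_lt (D := D) (hmeas.1 g hg) (hG g hg) (n := n)
      (c := 10 * M * U) (by positivity) ?_).trans (measure_mono fun w hw => ⟨g, hg, ?_⟩)
    · rw [mul_pow, mul_pow, hUsq]
      have h1 : (1 : ℝ) ≤ 3 * d + s + 1 := by
        have : (0 : ℝ) ≤ d := Nat.cast_nonneg d
        linarith
      have h2 : 0 < n * M ^ 2 := by positivity
      nlinarith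
    · have hw : |∑ i, g (w i) - n * ∫ x, g x ∂D| < 10 * M * U := hw
      have := abs_sub_le (∑ i, g (z i)) (∑ i, g (w i)) (n * ∫ x, g x ∂D)
      show 2 * (5 * M * U) < |∑ i, g (z i) - ∑ i, g (w i)|
      linarith
  have hsum : (2 : ℝ≥0∞) ^ n * (Q.prod Q) A ≤
      2 ^ n * (2 * ENNReal.ofReal (4 * Real.exp (-s))) := by
    calc (2 : ℝ≥0∞) ^ n * (Q.prod Q) A = ∑ _σ : Fin n → Bool, (Q.prod Q) A := by simp
      _ ≤ ∑ σ : Fin n → Bool, 2 * Q {z | ∃ g ∈ G, 5 * M * U < |∑ i, sgn (σ i) * g (z i)|} :=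
        Finset.sum_le_sum fun σ _ => prod_exists_abs_sub_gt_le G _ σ
      _ ≤ 2 * (2 ^ n * ENNReal.ofReal (4 * Real.exp (-s))) := by
        rw [← Finset.mul_sum]
        gcongr
        exact sum_measure_exists_sgn_sum_gt_le hd hM hG hmeas hn hs
      _ = _ := by ring
  rw [ENNReal.mul_le_mul_iff_right (by simp) (by simp)] at hsum
  refine hBA.trans ((mul_le_mul_right hsum 2).trans (le_of_eq ?_))
  rw [← mul_assoc, show (16 : ℝ) * Real.exp (-s) = 4 * (4 * Real.exp (-s)) by ring,
    ENNReal.ofReal_mul (by norm_num)]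
  norm_num

end Symmetrization

/-! ### The oracle inequality and the target sample. -/

section Learning

theorem card_le_of_pseudoDim_le {Z : Type*} {G : Set (Z → ℝ)} {d : ℕ} (h : pseudoDim G ≤ d)
    (s : Finset Z) (hs : PseudoShatters G s) : s.card ≤ d := by
  have : (s.card : ℕ∞) ≤ pseudoDim G :=
    le_iSup₂ (f := fun (s : Finset Z) (_ : PseudoShatters G s) => (s.card : ℕ∞)) s hs
  exact_mod_cast this.trans h

theorem integral_empirical {Z : Type*} [MeasurableSpace Z] {n : ℕ} (S : Fin n → Z) {g : Z → ℝ}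
    (hg : Measurable g) : ∫ x, g x ∂(empirical S) = (n : ℝ)⁻¹ * ∑ i, g (S i) := by
  unfold empirical
  rw [integral_smul_measure, integral_finsetSum_measure fun i _ =>
    integrable_dirac' hg.stronglyMeasurable (by simp)]
  simp [integral_dirac' _ _ hg.stronglyMeasurable]

theorem isFiniteMeasure_empirical {Z : Type*} [MeasurableSpace Z] {n : ℕ} (hn : 0 < n)
    (S : Fin n → Z) : IsFiniteMeasure (empirical S) := by
  constructor
  unfold empirical
  simp only [Measure.smul_apply, Measure.finsetSum_apply, measure_univ, smul_eq_mul]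
  refine ENNReal.mul_lt_top ?_ (by simp)
  simpa using hn

theorem isFiniteMeasure_mixedEmpirical {Z : Type*} [MeasurableSpace Z] {p : ℕ} {m : Fin p → ℕ}
    (hm : ∀ k, 0 < m k) (S : ∀ k, Fin (m k) → Z) (lam : Fin p → ℝ) :
    IsFiniteMeasure (mixedEmpirical S lam) := by
  constructor
  unfold mixedEmpirical mixture
  simp only [Measure.finsetSum_apply, Measure.smul_apply, smul_eq_mul]
  refine ENNReal.sum_lt_top.2 fun k _ => ENNReal.mul_lt_top ENNReal.ofReal_lt_top ?_
  have := isFiniteMeasure_empirical (hm k) (S k)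
  exact measure_lt_top _ _

variable {X Y : Type*} [Fintype Y] [MeasurableSpace X] [MeasurableSpace Y]
  {ℓ : stdSimplex ℝ Y → Y → ℝ} {H : Set (X → stdSimplex ℝ Y)} {M : ℝ}

theorem expLoss_nonneg (hℓ : ∀ q y, 0 ≤ ℓ q y ∧ ℓ q y ≤ M) (D : Measure (X × Y))
    (h : X → stdSimplex ℝ Y) : 0 ≤ expLoss ℓ D h :=
  integral_nonneg fun _ => (hℓ _ _).1

theorem expLoss_le (hℓ : ∀ q y, 0 ≤ ℓ q y ∧ ℓ q y ≤ M) (D : Measure (X × Y)) [IsFiniteMeasure D]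
    (h : X → stdSimplex ℝ Y) : expLoss ℓ D h ≤ M * D.real Set.univ := by
  have hb : ∀ z : X × Y, ‖ℓ (h z.1) z.2‖ ≤ M := fun z => by
    rw [Real.norm_eq_abs, abs_of_nonneg (hℓ _ _).1]
    exact (hℓ _ _).2
  exact (le_abs_self _).trans
    (norm_integral_le_of_norm_le_const (Filter.Eventually.of_forall hb))

/-- Finite masses and bounded losses make the supremum a genuine one; an unbounded real `⨆` would be
0. -/
theorem abs_sub_le_disc (hℓ : ∀ q y, 0 ≤ ℓ q y ∧ ℓ q y ≤ M) (D D' : Measure (X × Y))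
    [IsFiniteMeasure D] [IsFiniteMeasure D'] {h : X → stdSimplex ℝ Y} (hh : h ∈ H) :
    |expLoss ℓ D h - expLoss ℓ D' h| ≤ disc ℓ H D D' := by
  refine le_ciSup (f := fun h : H => |expLoss ℓ D h.1 - expLoss ℓ D' h.1|) ?_ ⟨h, hh⟩
  refine ⟨M * D.real Set.univ + M * D'.real Set.univ, ?_⟩
  rintro _ ⟨h, rfl⟩
  have h1 := expLoss_nonneg hℓ D h.1
  have h2 := expLoss_nonneg hℓ D' h.1
  have h3 := expLoss_le hℓ D h.1
  have h4 := expLoss_le hℓ D' h.1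
  exact abs_le.2 ⟨by linarith, by linarith⟩

theorem disc_nonneg (D D' : Measure (X × Y)) : 0 ≤ disc ℓ H D D' :=
  Real.iSup_nonneg fun _ => abs_nonneg _

section Penalty

variable {c ε δ : ℝ} {d p m₀ : ℕ} {m : Fin p → ℕ}

/-- The ε-term and the source term matter only through their nonnegativity, which the convention √t
= 0 for t < 0 secures whatever the sign of the logarithms. -/
theorem disc_add_le_penalty (hc : 0 ≤ c) (hM : 0 ≤ M) (hε : 0 ≤ ε) (S₀ : Fin m₀ → X × Y)
    (S : ∀ k, Fin (m k) → X × Y) (lam : Fin p → ℝ) :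
    disc ℓ H (empirical S₀) (mixedEmpirical S lam) + c * M * √(d + Real.log (1 / δ)) / √m₀
      ≤ penalty ℓ H c M ε δ d S₀ S lam := by
  unfold penalty
  have : 0 ≤ ε * M := by positivity
  have : 0 ≤ c * M * √(skewness lam m) / √((∑ k, m k : ℕ) : ℝ)
      * √(d * Real.log (Real.exp 1 * ((∑ k, m k : ℕ) : ℝ) / d) + p * Real.log (1 / (ε * δ))) := by
    positivity
  linarith

theorem mul_sqrt_div_le_penalty (hc : 0 ≤ c) (hM : 0 ≤ M) (hε : 0 ≤ ε) (hδ : 0 < δ) (hδ1 : δ ≤ 1)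
    (S₀ : Fin m₀ → X × Y) (S : ∀ k, Fin (m k) → X × Y) (lam : Fin p → ℝ) :
    c * M * √((d : ℝ) / m₀) ≤ penalty ℓ H c M ε δ d S₀ S lam := by
  refine le_trans ?_ (disc_add_le_penalty hc hM hε S₀ S lam)
  have hlog : 0 ≤ Real.log (1 / δ) := Real.log_nonneg (by rwa [one_div, one_le_inv₀ hδ])
  have h1 : c * M * √((d : ℝ) / m₀) ≤ c * M * √(d + Real.log (1 / δ)) / √m₀ := by
    rw [Real.sqrt_div (Nat.cast_nonneg d), ← mul_div_assoc]
    gcongr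
    linarith
  linarith [disc_nonneg (ℓ := ℓ) (H := H) (empirical S₀) (mixedEmpirical S lam)]

/-- On the event where the target sample estimates all losses up to `c M √(d + log (1/δ)) / √m₀`,
every solution satisfies the oracle inequality. -/
theorem expLoss_le_of_isSolution (hc : 0 ≤ c) (hM : 0 ≤ M) (hε : 0 ≤ ε)
    (hℓ : ∀ q y, 0 ≤ ℓ q y ∧ ℓ q y ≤ M) (hp : 0 < p) (hm₀ : 0 < m₀) (hm : ∀ k, 0 < m k)
    (D₀ : Measure (X × Y)) {S₀ : Fin m₀ → X × Y} {S : ∀ k, Fin (m k) → X × Y}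
    (hdev : ∀ h ∈ H, |expLoss ℓ (empirical S₀) h - expLoss ℓ D₀ h|
      ≤ c * M * √(d + Real.log (1 / δ)) / √m₀)
    {hR : X → stdSimplex ℝ Y} (hsol : IsSolution ℓ H c M ε δ d S₀ S hR) :
    expLoss ℓ D₀ hR ≤ (⨅ h : H, expLoss ℓ D₀ h.1)
      + 2 * ⨅ lam : stdSimplex ℝ (Fin p), penalty ℓ H c M ε δ d S₀ S lam.1 := by
  have : Nonempty (Fin p) := ⟨⟨0, hp⟩⟩
  have : Nonempty (stdSimplex ℝ (Fin p)) := inferInstance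
  have : Nonempty H := ⟨⟨hR, hsol.1⟩⟩
  have := isFiniteMeasure_empirical hm₀ S₀
  have hfin := fun lam => isFiniteMeasure_mixedEmpirical hm S lam
  set Δ := c * M * √(d + Real.log (1 / δ)) / √m₀
  have hpen : ∀ lam, disc ℓ H (empirical S₀) (mixedEmpirical S lam) + Δ
      ≤ penalty ℓ H c M ε δ d S₀ S lam := fun lam => disc_add_le_penalty hc hM hε S₀ S lam
  have hdisc : ∀ (lam : Fin p → ℝ), ∀ h ∈ H,
      |expLoss ℓ (empirical S₀) h - expLoss ℓ (mixedEmpirical S lam) h|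
        ≤ disc ℓ H (empirical S₀) (mixedEmpirical S lam) := fun lam h hh => by
    have := hfin lam
    exact abs_sub_le_disc hℓ _ _ hh
  have hlow : expLoss ℓ D₀ hR ≤ objective ℓ H c M ε δ d S₀ S hR := by
    refine le_ciInf fun lam => ?_
    have h1 := (abs_le.1 (hdev hR hsol.1)).1
    have h2 := (abs_le.1 (hdisc lam.1 hR hsol.1)).2
    have h3 := hpen lam.1
    linarith
  have hup : ∀ (h : H) (lam : stdSimplex ℝ (Fin p)),
      objective ℓ H c M ε δ d S₀ S h.1 ≤ expLoss ℓ D₀ h.1 + 2 * penalty ℓ H c M ε δ d S₀ S lam.1 := by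
    intro h lam
    have hbdd : BddBelow (Set.range fun lam : stdSimplex ℝ (Fin p) =>
        expLoss ℓ (mixedEmpirical S lam.1) h.1 + penalty ℓ H c M ε δ d S₀ S lam.1) := by
      refine ⟨0, ?_⟩
      rintro _ ⟨lam, rfl⟩
      have h1 := expLoss_nonneg hℓ (mixedEmpirical S lam.1) h.1
      have h2 := hpen lam.1
      have h3 := disc_nonneg (ℓ := ℓ) (H := H) (empirical S₀) (mixedEmpirical S lam.1)
      have h4 : 0 ≤ Δ := by positivity
      show 0 ≤ expLoss ℓ (mixedEmpirical S lam.1) h.1 + penalty ℓ H c M ε δ d S₀ S lam.1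
      linarith
    refine (ciInf_le hbdd lam).trans ?_
    have h1 := (abs_le.1 (hdev h.1 h.2)).2
    have h2 := (abs_le.1 (hdisc lam.1 h.1 h.2)).1
    have h3 := hpen lam.1
    linarith
  have hmain : ∀ (h : H) (lam : stdSimplex ℝ (Fin p)),
      expLoss ℓ D₀ hR ≤ expLoss ℓ D₀ h.1 + 2 * penalty ℓ H c M ε δ d S₀ S lam.1 := fun h lam =>
    hlow.trans ((hsol.2 h.1 h.2).trans (hup h lam))
  have h1 : ∀ lam : stdSimplex ℝ (Fin p), expLoss ℓ D₀ hR
      - 2 * penalty ℓ H c M ε δ d S₀ S lam.1 ≤ ⨅ h : H, expLoss ℓ D₀ h.1 := fun lam =>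
    le_ciInf fun h => by linarith [hmain h lam]
  have h2 : (expLoss ℓ D₀ hR - ⨅ h : H, expLoss ℓ D₀ h.1) / 2
      ≤ ⨅ lam : stdSimplex ℝ (Fin p), penalty ℓ H c M ε δ d S₀ S lam.1 :=
    le_ciInf fun lam => by linarith [h1 lam]
  linarith

end Penalty

/-- Uniform convergence of the empirical losses on an independent sample. -/
theorem measure_exists_expLoss_sub_gt_le {Ω : Type*} [MeasurableSpace Ω] {P : Measure Ω}
    [IsProbabilityMeasure P] (hℓ : ∀ q y, 0 ≤ ℓ q y ∧ ℓ q y ≤ M) (hM : 0 ≤ M) {d : ℕ}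
    (hd : pseudoDim (lossClass ℓ H) ≤ d) {n : ℕ} (hn : 0 < n) {D : Measure (X × Y)}
    [IsProbabilityMeasure D] (hmeas : IsMeasurableClass (lossClass ℓ H) D)
    {S : Fin n → Ω → X × Y} (hind : iIndepFun S P) (hlaw : ∀ i, HasLaw (S i) D P)
    {δ : ℝ} (hδ : 0 < δ) :
    P {ω | ∃ h ∈ H, 150 * M * √(d + Real.log (1 / δ)) / √n
        < |expLoss ℓ (empirical fun i => S i ω) h - expLoss ℓ D h|} ≤ ENNReal.ofReal (2 * δ) := by
  -- For δ ≥ 1/2 the bound is trivial; otherwise log(1/δ) ≥ log 2 absorbs the additive constants,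
  -- also when d = 0.
  rcases le_or_gt (1 / 2) δ with hδ2 | hδ2
  · refine prob_le_one.trans ?_
    rw [← ENNReal.ofReal_one]
    exact ENNReal.ofReal_le_ofReal (by linarith)
  have hn' : (0 : ℝ) < n := by exact_mod_cast hn
  set L := Real.log (1 / δ) with hL
  have hlog2 : Real.log 2 ≤ L := by
    refine Real.log_le_log two_pos ?_
    rw [le_div_iff₀ hδ]
    linarith
  have hlog2' := Real.log_two_gt_d9
  have hlog8 : Real.log 8 = 3 * Real.log 2 := by
    rw [show (8 : ℝ) = 2 ^ 3 by norm_num, Real.log_pow]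
    norm_num
  -- Chosen so that 16e^(-s) = 2δ.
  set s := Real.log 8 + L with hs
  have hs0 : 0 ≤ s := by linarith
  have hexp : 16 * Real.exp (-s) = 2 * δ := by
    rw [hs, hL, ← Real.log_mul (by norm_num) (by positivity), Real.exp_neg,
      Real.exp_log (by positivity)]
    field_simp
    norm_num
  set Q := Measure.pi fun _ : Fin n => D
  set B : Set (Fin n → X × Y) := {z | ∃ g ∈ lossClass ℓ H,
    20 * M * √(8 * n * (3 * d + s + 1)) < |∑ i, g (z i) - n * ∫ x, g x ∂D|}
  have hB : Q B ≤ ENNReal.ofReal (2 * δ) := by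
    rw [← hexp]
    refine measure_exists_abs_sum_sub_gt_le (card_le_of_pseudoDim_le hd) hM ?_ hmeas hn hs0
    rintro _ ⟨h, -, rfl⟩ x
    exact hℓ _ _
  have hmap : P.map (fun ω i => S i ω) = Q := by
    rw [hind.map_fun_eq_pi_map fun i => (hlaw i).aemeasurable]
    simp_rw [(hlaw _).map_eq]
    rfl
  have haem : AEMeasurable (fun ω i => S i ω) P :=
    aemeasurable_pi_lambda _ fun i => (hlaw i).aemeasurable
  have hsub : {ω | ∃ h ∈ H, 150 * M * √(d + L) / √n
      < |expLoss ℓ (empirical fun i => S i ω) h - expLoss ℓ D h|} ⊆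
      (fun ω i => S i ω) ⁻¹' toMeasurable Q B := by
    rintro ω ⟨h, hh, hgt⟩
    refine subset_toMeasurable _ _ ⟨lossFun ℓ h, ⟨h, hh, rfl⟩, ?_⟩
    have h1 : expLoss ℓ (empirical fun i => S i ω) h = (n : ℝ)⁻¹ * ∑ i, lossFun ℓ h (S i ω) :=
      integral_empirical _ (hmeas.1 _ ⟨h, hh, rfl⟩)
    have h2 : expLoss ℓ D h = ∫ x, lossFun ℓ h x ∂D := rfl
    rw [h1, h2] at hgt
    have h3 : |(n : ℝ)⁻¹ * ∑ i, lossFun ℓ h (S i ω) - ∫ x, lossFun ℓ h x ∂D|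
        = |∑ i, lossFun ℓ h (S i ω) - n * ∫ x, lossFun ℓ h x ∂D| / n := by
      rw [← abs_of_pos hn', ← abs_div, abs_of_pos hn']
      congr 1
      field_simp
    rw [h3, div_lt_div_iff₀ (Real.sqrt_pos.2 hn') hn'] at hgt
    have hsq : (n : ℝ) = √n * √n := (Real.mul_self_sqrt hn'.le).symm
    have h4 : 150 * M * √(d + L) * √n
        < |∑ i, lossFun ℓ h (S i ω) - n * ∫ x, lossFun ℓ h x ∂D| := by
      refine lt_of_mul_lt_mul_right ?_ (Real.sqrt_nonneg n)
      calc 150 * M * √(d + L) * √n * √n = 150 * M * √(d + L) * n := by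
            rw [mul_assoc (150 * M * √(d + L)), ← hsq]
        _ < _ := hgt
    refine lt_of_le_of_lt ?_ h4
    have hdL : 0 ≤ d + L := by
      have : (0 : ℝ) ≤ d := Nat.cast_nonneg d
      linarith
    have h5 : √(8 * n * (3 * d + s + 1)) ≤ 15 / 2 * (√(d + L) * √n) := by
      refine Real.sqrt_le_iff.2 ⟨by positivity, ?_⟩
      rw [mul_pow, mul_pow, Real.sq_sqrt hdL, Real.sq_sqrt hn'.le]
      have h6 : 8 * (3 * d + s + 1) ≤ (15 / 2 : ℝ) ^ 2 * (d + L) := by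
        have : (0 : ℝ) ≤ d := Nat.cast_nonneg d
        rw [hs, hlog8]
        linarith
      calc 8 * n * (3 * d + s + 1) = 8 * (3 * d + s + 1) * n := by ring
        _ ≤ (15 / 2 : ℝ) ^ 2 * (d + L) * n := by gcongr
        _ = _ := by ring
    calc 20 * M * √(8 * n * (3 * d + s + 1)) ≤ 20 * M * (15 / 2 * (√(d + L) * √n)) := by gcongr
      _ = 150 * M * √(d + L) * √n := by ring
  refine (measure_mono hsub).trans ?_
  rw [← Measure.map_apply_of_aemeasurable haem (measurableSet_toMeasurable _ _), hmap,
    measure_toMeasurable]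
  exact hB

end Learning

end

/-- The probability of the bad event is an outer probability, so that `P {bad} ≤ 2δ` says that the
good event contains a measurable event of probability at least `1 - 2δ`. -/
theorem lemma4 :
    ∃ c : ℝ, 0 < c ∧
      ∀ (X : Type*) (Y : Type*) (Ω : Type*) [MeasurableSpace X] [Fintype Y] [MeasurableSpace Y]
        [DiscreteMeasurableSpace Y] [MeasurableSpace Ω] (P : Measure Ω) [IsProbabilityMeasure P]
        (M : ℝ) (ℓ : stdSimplex ℝ Y → Y → ℝ) (_ : ∀ q y, 0 ≤ ℓ q y ∧ ℓ q y ≤ M)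
        (H : Set (X → stdSimplex ℝ Y))
        (d : ℕ) (_ : pseudoDim (lossClass ℓ H) = (d : ℕ∞))
        (p : ℕ) (_ : 0 < p) (m₀ : ℕ) (_ : 0 < m₀) (m : Fin p → ℕ) (_ : ∀ k, 0 < m k)
        (D₀ : Measure (X × Y)) [IsProbabilityMeasure D₀]
        (D : Fin p → Measure (X × Y)) [∀ k, IsProbabilityMeasure (D k)]
        (_ : IsMeasurableClass (lossClass ℓ H) D₀)
        (S₀ : Fin m₀ → Ω → X × Y) (_ : iIndepFun S₀ P) (_ : ∀ i, HasLaw (S₀ i) D₀ P)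
        (S : ∀ k, Fin (m k) → Ω → X × Y) (_ : ∀ k, iIndepFun (S k) P)
        (_ : ∀ k i, HasLaw (S k i) (D k) P)
        (ε δ : ℝ) (_ : 0 < ε) (_ : 0 < δ) (_ : δ ≤ 1),
        P {ω | ¬ ∀ hR : X → stdSimplex ℝ Y,
            IsSolution ℓ H c M ε δ d (fun i => S₀ i ω) (fun k i => S k i ω) hR →
            expLoss ℓ D₀ hR ≤ (⨅ h : H, expLoss ℓ D₀ h.1)
              + 2 * ⨅ lam : stdSimplex ℝ (Fin p),
                  penalty ℓ H c M ε δ d (fun i => S₀ i ω) (fun k i => S k i ω) lam.1}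
          ≤ ENNReal.ofReal (2 * δ)
        ∧ ∀ (ω : Ω) (lam : stdSimplex ℝ (Fin p)),
            c * M * √((d : ℝ) / m₀)
              ≤ penalty ℓ H c M ε δ d (fun i => S₀ i ω) (fun k i => S k i ω) lam.1 := by
  -- 150 = 20·(15/2): the deviation constant times the cost of replacing √(8(3d+s+1)) by √(d +
  -- log(1/δ)).
  refine ⟨150, by norm_num, ?_⟩
  intro X Y Ω _ _ _ _ _ P _ M ℓ hℓ H d hd p hp m₀ hm₀ m hm D₀ _ D _ hmeas S₀ hind hlaw S _ _ ε δ
    hε hδ hδ1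
  have hM : 0 ≤ M := by
    obtain ⟨z⟩ := nonempty_of_isProbabilityMeasure D₀
    have : Nonempty Y := ⟨z.2⟩
    obtain ⟨q⟩ : Nonempty (stdSimplex ℝ Y) := inferInstance
    exact (hℓ q z.2).1.trans (hℓ q z.2).2
  refine ⟨?_, fun ω lam => mul_sqrt_div_le_penalty (by norm_num) hM hε.le hδ hδ1 _ _ _⟩
  refine (measure_mono fun ω hω => ?_).trans
    (measure_exists_expLoss_sub_gt_le hℓ hM hd.le hm₀ hmeas hind hlaw hδ)
  by_contra hdev
  refine hω fun hR hsol => expLoss_le_of_isSolution (by norm_num) hM hε.le hℓ hp hm₀ hm D₀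
    (fun h hh => ?_) hsol
  by_contra hgt
  exact hdev ⟨h, hh, not_le.1 hgt⟩
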